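/- Let $W$ be a one-dimensional real-valued Brownian motion on a probability space $(\Omega,\mathscr F,\mathbb P)$, let $s>\tfrac12$, let $\sigma\ge 0$ be an integer, let $T>0$, $N\in\mathbb N^+$, $\delta t=T/N$, $t_n=n\,\delta t$ and $\delta W_n=W(t_{n+1})-W(t_n)$. For $r\in\mathbb R$ let $\exp(\mathrm i r\Delta)$ be the Fourier multiplier on $L^2=L^2(\mathbb R;\mathbb C)$ with symbol $e^{-\mathrm i r|2\pi\xi|^2}$, where $\hat u(\xi)=\int u(x)e^{-2\pi \mathrm i x\xi}\,dx$. The Lie splitting scheme for $\mathrm i\,du+\Delta u\circ dW+|u|^{2\sigma}u\,dt=0$ with initial value $u^0\in L^2$ is $$\tilde u^n=\exp(\mathrm i\,\delta t\,|u^n|^{2\sigma})\,u^n,\qquad u^{n+1}=\exp(\mathrm i\,\delta W_n\,\Delta)\,\tilde u^n,\qquad 0\le n\le N-1 .$$ Let $Q(u)=\int_{\mathbb R}|u|^2\,dx$ and write $u^n=p^n+\mathrm i q^n$ with $p^n,q^n$ real. (1) Almost surely, for $0\le n\le N$ the map $u^0\mapsto u^n$ sends $H^s(\mathbb R;\mathbb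 C)$ to itself and is (real) Fréchet differentiable there. Let $\bar\omega^n=\int_{\mathbb R}dp^n\wedge dq^n\,dx$ be the two-form on $H^s$ given at $u^0$ by $\bar\omega^n(h,k)=\int_{\mathbb R}\big(dp^n(h)\,dq^n(k)-dp^n(k)\,dq^n(h)\big)\,dx$ for $h,k\in H^s$, where $dp^n,dq^n$ are the differentials of $p^n,q^n$ with respect to $u^0$. Then, almost surely, $$\bar\omega^{n+1}=\bar\omega^n \ \text{ on } H^s,\qquad Q(u^{n+1})=Q(u^n)\ \text{ for all } u^0\in L^2,\qquad 0\le n\le N-1 .$$ (2) Each substep is the exact flow of an infinite-dimensional Hamiltonian system, $\dot p=-\frac{\delta H}{\delta q}$, $\dot q=\frac{\delta H}{\delta p}$, with respect to time $t$ for $H=H_2:=\frac1{2\sigma+2}\int_{\mathbb R}|u|^{2\sigma+2}dx$ and driven by $W$ for $H=H_1:=-\frac12\int_{\mathbb R}|\nabla u|^2dx$. Precisely: (a) for $u_0\in H^s$ the curve $u(t)=\exp(\mathrm i t|u_0|^{2\sigma})u_0$, $t\in\mathbb R$, is differentiable in $H^s$, $u(0)=u_0$, and $u'=\mathrm i|u|^{2\sigma}u$,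 where $|u|^{2\sigma}u=\frac{\delta H_2}{\delta p}(u)+\mathrm i\frac{\delta H_2}{\delta q}(u)$; (b) for $u^0\in L^2$ and $0\le n\le N-1$ the process $u(t)=\exp\big(\mathrm i(W(t)-W(t_n))\Delta\big)\tilde u^n$ has almost surely continuous paths in $L^2$ on $[t_n,t_{n+1}]$ and satisfies $du=\mathrm i\Delta u\circ dW$ there, in integrated form and in the sense of tempered distributions, the Stratonovich integral being the limit in probability of trapezoidal sums; and for $v\in H^2$ the curve $v(r)=\exp(\mathrm i r\Delta)v$, $r\in\mathbb R$, is differentiable in $L^2$, $v(0)=v$, and $v'=\mathrm i\Delta v$, where $\Delta v=\frac{\delta H_1}{\delta p}(v)+\mathrm i\frac{\delta H_1}{\delta q}(v)$. Here variational derivatives are taken in the directions of Schwartz functions. (3) For each $\tau,r\in\mathbb R$ and $f\in L^2$, multiplication by $\exp(\mathrm i\tau|f|^{2\sigma})$ and $\exp(\mathrm i r\Delta)$ are unitary operators on $L^2$. -/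

import Mathlib

open MeasureTheory ProbabilityTheory TemperedDistribution
open scoped NNReal ENNReal SchwartzMap FourierTransform Laplacian LineDeriv

noncomputable section

namespace WhiteNoiseNLS

/-- The complex Hilbert space `L²(ℝ; ℂ)`. -/
abbrev L2 : Type := Lp ℂ 2 (volume : Measure ℝ)

/-! ### The Sobolev space `H^s(ℝ; ℂ)` with its norm -/

/-- The square integrable functions that belong to the Sobolev space of order `s`. -/
def sobolevSubmodule (s : ℝ) : Submodule ℂ L2 where
  carrier := {f | MemSobolev s 2 (f : 𝓢'(ℝ, ℂ))}
  add_mem' {f g} hf hg := by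
    have h := MemSobolev.add hf hg
    simp only [← Lp.toTemperedDistributionCLM_apply, ← map_add] at h
    exact h
  zero_mem' := by
    have h := memSobolev_fun_zero ℝ ℂ s 2
    rw [← map_zero (Lp.toTemperedDistributionCLM ℂ (volume : Measure ℝ) 2)] at h
    exact h
  smul_mem' c f hf := by
    have h := MemSobolev.smul c hf
    simp only [← Lp.toTemperedDistributionCLM_apply, ← map_smul] at h
    exact h

/-- `H^s(ℝ; ℂ)` for `s ≥ 0`. It is a type of its own because it does not carry the norm of `L²`. -/
def Hs (s : ℝ) : Type := sobolevSubmodule s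

instance (s : ℝ) : AddCommGroup (Hs s) := inferInstanceAs (AddCommGroup (sobolevSubmodule s))

instance (s : ℝ) : Module ℂ (Hs s) := inferInstanceAs (Module ℂ (sobolevSubmodule s))

/-- The inclusion of `H^s` in `L²`. -/
def Hs.toL2 {s : ℝ} : Hs s →ₗ[ℂ] L2 := (sobolevSubmodule s).subtype

theorem Hs.toL2_injective {s : ℝ} : Function.Injective (Hs.toL2 (s := s)) :=
  Subtype.val_injective

theorem Hs.memSobolev {s : ℝ} (u : Hs s) : MemSobolev s 2 (u.toL2 : 𝓢'(ℝ, ℂ)) := u.2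

theorem toTemperedDistribution_injective {f g : L2}
    (h : (f : 𝓢'(ℝ, ℂ)) = (g : 𝓢'(ℝ, ℂ))) : f = g := by
  have hk := Lp.ker_toTemperedDistributionCLM_eq_bot (F := ℂ) (μ := (volume : Measure ℝ)) (p := 2)
  exact LinearMap.ker_eq_bot.mp hk h

/-- The function `𝓕⁻¹ ((1 + |ξ|²)^{s/2} 𝓕 u)`. -/
def Hs.besselFun {s : ℝ} (u : Hs s) : L2 := Classical.choose u.memSobolev

theorem Hs.besselFun_spec {s : ℝ} (u : Hs s) :
    besselPotential ℝ ℂ s (u.toL2 : 𝓢'(ℝ, ℂ)) = (u.besselFun : 𝓢'(ℝ, ℂ)) :=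
  Classical.choose_spec u.memSobolev

theorem Hs.besselFun_eq {s : ℝ} (u : Hs s) {f : L2}
    (h : besselPotential ℝ ℂ s (u.toL2 : 𝓢'(ℝ, ℂ)) = (f : 𝓢'(ℝ, ℂ))) : u.besselFun = f :=
  toTemperedDistribution_injective (u.besselFun_spec.symm.trans h)

/-- The map `u ↦ 𝓕⁻¹ ((1 + |ξ|²)^{s/2} 𝓕 u)` from `H^s` to `L²`. -/
def Hs.bessel {s : ℝ} : Hs s →ₗ[ℂ] L2 where
  toFun u := u.besselFun
  map_add' u v := by
    apply Hs.besselFun_eq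
    have hu := u.besselFun_spec
    have hv := v.besselFun_spec
    rw [← Lp.toTemperedDistributionCLM_apply] at hu hv ⊢
    rw [← Lp.toTemperedDistributionCLM_apply] at hu hv ⊢
    rw [map_add, map_add, map_add, hu, hv]
    exact (map_add _ _ _).symm
  map_smul' c u := by
    apply Hs.besselFun_eq
    have hu := u.besselFun_spec
    rw [← Lp.toTemperedDistributionCLM_apply] at hu ⊢
    rw [← Lp.toTemperedDistributionCLM_apply] at hu ⊢
    rw [map_smul, map_smul, map_smul, hu, RingHom.id_apply]
    exact (map_smul _ _ _).symm

theorem Hs.bessel_spec {s : ℝ} (u : Hs s) :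
    besselPotential ℝ ℂ s (u.toL2 : 𝓢'(ℝ, ℂ)) = (u.bessel : 𝓢'(ℝ, ℂ)) :=
  u.besselFun_spec

theorem Hs.bessel_injective {s : ℝ} : Function.Injective (Hs.bessel (s := s)) := by
  intro u v h
  apply Hs.toL2_injective
  apply toTemperedDistribution_injective
  have h1 := Hs.bessel_spec u
  rw [h, ← Hs.bessel_spec v] at h1
  have h2 := congrArg (besselPotential ℝ ℂ (-s)) h1
  simpa using h2

/-- The norm of `H^s` is `‖u‖ = ‖(1 + |ξ|²)^{s/2} 𝓕 u‖` in `L²`. -/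
instance (s : ℝ) : NormedAddCommGroup (Hs s) :=
  NormedAddCommGroup.induced (Hs s) L2 Hs.bessel Hs.bessel_injective

instance (s : ℝ) : NormedSpace ℂ (Hs s) :=
  NormedSpace.induced ℂ (Hs s) L2 Hs.bessel

/-! ### The Lie splitting scheme -/

theorem memLp_phase (θ : ℝ → ℝ) (hθ : AEMeasurable θ) (f : L2) :
    MemLp (fun x => Complex.exp (Complex.I * (θ x : ℂ)) * f x) 2 (volume : Measure ℝ) := by
  refine MemLp.of_le (Lp.memLp f) ?_ (Filter.Eventually.of_forall fun x => ?_)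
  · have h : AEMeasurable (fun x => Complex.exp (Complex.I * (θ x : ℂ))) (volume : Measure ℝ) := by
      fun_prop
    exact h.aestronglyMeasurable.mul (Lp.aestronglyMeasurable f)
  · rw [norm_mul, mul_comm Complex.I, Complex.norm_exp_ofReal_mul_I, one_mul]

/-- Multiplication by `exp(i θ)`. -/
def phaseMul (θ : ℝ → ℝ) (hθ : AEMeasurable θ) (f : L2) : L2 := (memLp_phase θ hθ f).toLp

theorem aemeasurable_nlPhase (σ : ℕ) (τ : ℝ) (f : L2) :
    AEMeasurable (fun x => τ * ‖f x‖ ^ (2 * σ)) := by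
  have h := (Lp.aestronglyMeasurable f).aemeasurable
  fun_prop

theorem aemeasurable_freePhase (r : ℝ) :
    AEMeasurable (fun ξ : ℝ => -r * (2 * Real.pi * ξ) ^ 2) := by
  fun_prop

/-- The nonlinear substep `u ↦ exp(i τ |u|^{2σ}) u`. -/
def nlStep (σ : ℕ) (τ : ℝ) (f : L2) : L2 :=
  phaseMul (fun x => τ * ‖f x‖ ^ (2 * σ)) (aemeasurable_nlPhase σ τ f) f

/-- The linear substep `exp(i r Δ)`, the Fourier multiplier with symbol `exp(-i r (2 π ξ)²)`. -/
def freeStep (r : ℝ) (f : L2) : L2 :=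
  𝓕⁻ (phaseMul (fun ξ => -r * (2 * Real.pi * ξ) ^ 2) (aemeasurable_freePhase r) (𝓕 f))

/-- The grid point `t_n = n T / N`. -/
def gridTime (T : ℝ≥0) (N n : ℕ) : ℝ≥0 := n * T / N

/-- The increment `W(t_{n+1}) - W(t_n)` of the path `w`. -/
def increment (w : ℝ≥0 → ℝ) (T : ℝ≥0) (N n : ℕ) : ℝ :=
  w (gridTime T N (n + 1)) - w (gridTime T N n)

/-- The value `u^n` of the Lie splitting scheme along the driving path `w`, started at `u⁰ = u₀`. -/
def lieScheme (σ : ℕ) (T : ℝ≥0) (N : ℕ) (w : ℝ≥0 → ℝ) : ℕ → L2 → L2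
  | 0, u₀ => u₀
  | n + 1, u₀ =>
    freeStep (increment w T N n) (nlStep σ ((T : ℝ) / N) (lieScheme σ T N w n u₀))

/-- The intermediate value `exp(i δt |u^n|^{2σ}) u^n` of the scheme. -/
def lieIntermediate (σ : ℕ) (T : ℝ≥0) (N : ℕ) (w : ℝ≥0 → ℝ) (n : ℕ) (u₀ : L2) : L2 :=
  nlStep σ ((T : ℝ) / N) (lieScheme σ T N w n u₀)

/-! ### The charge and the symplectic structure -/

/-- The charge `Q(u) = ∫ |u|² dx`. -/
def charge (f : L2) : ℝ := ∫ x, ‖f x‖ ^ 2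

/-- The value of `∫ dp ∧ dq dx` on two tangent vectors `h` and `k`. -/
def symplecticForm (h k : L2) : ℝ := ∫ x, ((h x).re * (k x).im - (k x).re * (h x).im)

/-- The two-form `ω̄^n = ∫ dp^n ∧ dq^n dx` on the phase space `H^s`, at the initial value `u` and on
the tangent vectors `h`, `k`; the differential is the Fréchet derivative of `u⁰ ↦ u^n = p^n + i q^n`
with respect to the initial value, over the real numbers. -/
def schemeForm (s : ℝ) (σ : ℕ) (T : ℝ≥0) (N : ℕ) (w : ℝ≥0 → ℝ) (n : ℕ) (u h k : Hs s) : ℝ :=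
  symplecticForm
    (fderiv ℝ (fun v : Hs s => lieScheme σ T N w n v.toL2) u h)
    (fderiv ℝ (fun v : Hs s => lieScheme σ T N w n v.toL2) u k)

/-! ### Hamiltonian systems -/

open Classical in
/-- The distributional derivative of `f` if it is square integrable (and `0` otherwise). -/
def weakDeriv (f : L2) : L2 :=
  if h : ∃ g : L2, ∂_{(1 : ℝ)} (f : 𝓢'(ℝ, ℂ)) = (g : 𝓢'(ℝ, ℂ)) then h.choose else 0

/-- `H₁(u) = -(1/2) ∫ |∇u|² dx`. -/
def energyH1 (f : L2) : ℝ := -(1 / 2) * ∫ x, ‖weakDeriv f x‖ ^ 2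

/-- `H₂(u) = 1/(2σ+2) ∫ |u|^{2σ+2} dx`. -/
def energyH2 (σ : ℕ) (f : L2) : ℝ := 1 / (2 * (σ : ℝ) + 2) * ∫ x, ‖f x‖ ^ (2 * σ + 2)

/-- `g = δH/δp + i δH/δq` at `u = p + i q`: the derivative of `H` at `u` in the direction of each
Schwartz function `φ` is `∫ (δH/δp Re φ + δH/δq Im φ) dx`. -/
def HasVariationalDerivative (H : L2 → ℝ) (u g : L2) : Prop :=
  ∀ φ : 𝓢(ℝ, ℂ), HasDerivAt (fun ε : ℝ => H (u + ε • φ.toLp 2 (volume : Measure ℝ)))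
    (∫ x, ((g x).re * (φ x).re + (g x).im * (φ x).im)) 0

/-! ### The Stratonovich equation `du = i Δu ∘ dW` -/

section

variable {Ω : Type*} [MeasurableSpace Ω]

/-- `J` is the Stratonovich integral `∫_a^b X ∘ dW`: the limit in probability of the trapezoidal
sums over the partitions of `[a, b]` as their mesh tends to `0`. -/
def HasStratonovichIntegral (P : Measure Ω) (W : ℝ≥0 → Ω → ℝ) (X : ℝ≥0 → Ω → ℂ) (a b : ℝ≥0)
    (J : Ω → ℂ) : Prop :=
  ∀ ε : ℝ, 0 < ε → ∀ η : ℝ, 0 < η → ∃ δ : ℝ, 0 < δ ∧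
    ∀ (m : ℕ) (τ : ℕ → ℝ≥0), Monotone τ → τ 0 = a → τ m = b →
      (∀ i < m, (τ (i + 1) : ℝ) - τ i ≤ δ) →
      P {ω | ε ≤ ‖(∑ i ∈ Finset.range m, (X (τ i) ω + X (τ (i + 1)) ω) / 2 *
        ((W (τ (i + 1)) ω - W (τ i) ω : ℝ) : ℂ)) - J ω‖} ≤ ENNReal.ofReal η

/-- The process `u` has almost surely continuous paths in `L²` on `[a, b]` and satisfies
`u(t) = u(a) + ∫_a^t i Δu ∘ dW` for `a ≤ t ≤ b` in the sense of tempered distributions. -/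
def SolvesLinearEquation (P : Measure Ω) (W : ℝ≥0 → Ω → ℝ) (a b : ℝ≥0) (u : ℝ≥0 → Ω → L2) :
    Prop :=
  (∀ᵐ ω ∂P, ContinuousOn (fun t => u t ω) (Set.Icc a b)) ∧
  ∀ t ∈ Set.Icc a b, ∀ φ : 𝓢(ℝ, ℂ),
    HasStratonovichIntegral P W
      (fun r ω => Complex.I * (Δ (u r ω : 𝓢'(ℝ, ℂ))) φ) a t
      (fun ω => (u t ω : 𝓢'(ℝ, ℂ)) φ - (u a ω : 𝓢'(ℝ, ℂ)) φ)

end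

end WhiteNoiseNLS

end

open WhiteNoiseNLS

/-!
The nonlinear substep rotates each value `u x` by the phase `t ‖u x‖ ^ (2σ)`, so it keeps the
modulus and is the exact flow of its Hamiltonian system; it is differentiable on `H^s` because
`H^s` is an algebra for `s > 1/2`. The linear substep is a unimodular Fourier multiplier, hence a
unitary operator of `L²`, and it commutes with the Bessel potential. The symplectic form of `h, k`
is `∫ Im (conj h * k)`, the imaginary part of the inner product: the unitary linear substep
preserves it, and the derivative of the nonlinear one is pointwise a rotation composed with a shear
of determinant one.

For the Stratonovich equation, test with a Schwartz function `φ`: the function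
`r ↦ ⟨exp(irΔ) f, φ⟩` has its third derivative bounded by `‖Δ³ φ‖ * ‖f‖`, so the trapezoidal rule
errs by a multiple of `|δW|³` over each cell of a partition. The expected sum of these errors is of
the order of the square root of the mesh, hence tends to zero in probability.
-/

noncomputable section

namespace WhiteNoiseNLS

section FourierL2

variable {V F : Type*} [NormedAddCommGroup V] [InnerProductSpace ℝ V] [FiniteDimensional ℝ V]
  [MeasurableSpace V] [BorelSpace V] [NormedAddCommGroup F]

theorem ae_eq_of_integral_schwartzMap_smul_eq {V : Type*} [NormedAddCommGroup V] [NormedSpace ℝ V]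
    [FiniteDimensional ℝ V] [MeasurableSpace V] [BorelSpace V] [NormedSpace ℂ F] [CompleteSpace F]
    {μ : Measure V} {f g : V → F}
    (hf : LocallyIntegrable f μ) (hg : LocallyIntegrable g μ)
    (h : ∀ φ : 𝓢(V, ℂ), ∫ x, φ x • f x ∂μ = ∫ x, φ x • g x ∂μ) : f =ᵐ[μ] g := by
  refine ae_eq_of_integral_contDiff_smul_eq hf hg fun θ hθ hθc => ?_
  have hsupp : HasCompactSupport (Complex.ofRealCLM ∘ θ) := hθc.comp_left rfl
  exact h (hsupp.toSchwartzMap (by fun_prop))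

theorem locallyIntegrable_coeFn_Lp_two (f : Lp (α := V) F 2) : LocallyIntegrable f :=
  (Lp.memLp f).locallyIntegrable one_le_two

variable [InnerProductSpace ℂ F]

theorem continuous_fourierInv_of_integrable {f : V → F} (hf : Integrable f) :
    Continuous (𝓕⁻ f) :=
  VectorFourier.fourierIntegral_continuous Real.continuous_fourierChar
    (by simp only [LinearMap.neg_apply, innerₗ_apply_apply]; fun_prop) hf

theorem laplacian_eq_fourierMultiplierCLM_negLaplaceSymbol (f : 𝓢'(V, F)) :
    Δ f = fourierMultiplierCLM F (fun ξ => -((2 * Real.pi * ‖ξ‖) ^ 2 : ℝ)) f := by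
  have hsymbol : (fun ξ : V => (-((2 * Real.pi * ‖ξ‖) ^ 2 : ℝ) : ℂ)) =
      (-(2 * Real.pi) ^ 2 : ℂ) • fun ξ : V => Complex.ofReal (‖ξ‖ ^ 2) := by
    ext ξ
    simp only [Pi.smul_apply, smul_eq_mul]
    push_cast
    ring
  rw [TemperedDistribution.laplacian_eq_fourierMultiplierCLM, hsymbol,
    fourierMultiplierCLM_smul (by fun_prop)]
  ext φ
  simp [← Complex.coe_smul]

variable [CompleteSpace F]

theorem integral_schwartzMap_smul_fourierInv (f : Lp (α := V) F 2) (φ : 𝓢(V, ℂ)) :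
    ∫ x, φ x • (𝓕⁻ f : Lp (α := V) F 2) x = ∫ x, (𝓕⁻ φ) x • f x := by
  have h := congrArg (fun T : 𝓢'(V, F) => T φ) (Lp.fourierInv_toTemperedDistribution_eq f)
  simpa only [fourierInv_apply, Lp.toTemperedDistribution_apply] using h.symm

theorem integral_fourierInv_smul_eq_flip {f : V → ℂ} {g : V → F} (hf : Integrable f)
    (hg : Integrable g) : ∫ x, 𝓕⁻ f x • g x = ∫ x, f x • 𝓕⁻ g x := by
  have h := VectorFourier.integral_fourierIntegral_smul_eq_flip (L := -innerₗ V)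
    (μ := (volume : Measure V)) (ν := (volume : Measure V)) Real.continuous_fourierChar
    (by simp only [LinearMap.neg_apply, innerₗ_apply_apply]; fun_prop) hf hg
  have flip_neg_innerₗ : (-innerₗ V).flip = -innerₗ V := by
    ext v w
    simp [real_inner_comm]
  rwa [flip_neg_innerₗ] at h

theorem coeFn_fourierInv_of_integrable {f : Lp (α := V) F 2} (hf : Integrable f) :
    (𝓕⁻ f : Lp (α := V) F 2) =ᵐ[volume] 𝓕⁻ (f : V → F) := by
  refine ae_eq_of_integral_schwartzMap_smul_eq (locallyIntegrable_coeFn_Lp_two _)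
    (continuous_fourierInv_of_integrable hf).locallyIntegrable fun φ => ?_
  rw [integral_schwartzMap_smul_fourierInv, SchwartzMap.fourierInv_coe,
    integral_fourierInv_smul_eq_flip φ.integrable hf]

theorem fourierMultiplierCLM_apply_Lp_two {m : V → ℂ} (hm : m.HasTemperateGrowth)
    (f : Lp (α := V) F 2) (φ : 𝓢(V, ℂ)) :
    fourierMultiplierCLM F m (f : 𝓢'(V, F)) φ =
      ∫ ξ, (𝓕⁻ φ) ξ • m ξ • (𝓕 f : Lp (α := V) F 2) ξ := by
  rw [fourierMultiplierCLM_apply, fourierInv_apply, smulLeftCLM_apply_apply,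
    Lp.fourier_toTemperedDistribution_eq, Lp.toTemperedDistribution_apply]
  simp only [SchwartzMap.smulLeftCLM_apply_apply hm, smul_smul, smul_eq_mul, mul_comm]

theorem toTemperedDistribution_apply_eq_integral_fourier (f : Lp (α := V) F 2) (φ : 𝓢(V, ℂ)) :
    (f : 𝓢'(V, F)) φ = ∫ ξ, (𝓕⁻ φ) ξ • (𝓕 f : Lp (α := V) F 2) ξ := by
  rw [← integral_schwartzMap_smul_fourierInv, FourierTransform.fourierInv_fourier_eq,
    Lp.toTemperedDistribution_apply]

theorem fourierMultiplierCLM_eq_iff {m : V → ℂ} (hm : m.HasTemperateGrowth)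
    {f g : Lp (α := V) F 2} :
    fourierMultiplierCLM F m (f : 𝓢'(V, F)) = (g : 𝓢'(V, F)) ↔
      (𝓕 g : Lp (α := V) F 2) =ᵐ[volume] fun ξ => m ξ • (𝓕 f : Lp (α := V) F 2) ξ := by
  constructor
  · intro h
    have hloc : LocallyIntegrable fun ξ => m ξ • (𝓕 f : Lp F 2 (volume : Measure V)) ξ := by
      have := (locallyIntegrable_coeFn_Lp_two (𝓕 f)).locallyIntegrableOn Set.univ
      rw [← locallyIntegrableOn_univ]
      exact this.continuousOn_smul isOpen_univ.isLocallyClosed hm.1.continuous.continuousOn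
    refine ae_eq_of_integral_schwartzMap_smul_eq (locallyIntegrable_coeFn_Lp_two _) hloc
      fun φ => ?_
    have hφ := congrArg (fun T : 𝓢'(V, F) => T (𝓕 φ)) h
    simpa only [fourierMultiplierCLM_apply_Lp_two hm,
      toTemperedDistribution_apply_eq_integral_fourier, FourierTransform.fourierInv_fourier_eq]
      using hφ.symm
  · intro h
    ext φ
    rw [fourierMultiplierCLM_apply_Lp_two hm, toTemperedDistribution_apply_eq_integral_fourier]
    refine integral_congr_ae ?_
    filter_upwards [h] with ξ hξ
    rw [hξ]

theorem lineDeriv_eq_iff_fourier {v : V} {f g : Lp (α := V) F 2} :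
    ∂_{v} (f : 𝓢'(V, F)) = (g : 𝓢'(V, F)) ↔ (𝓕 g : Lp (α := V) F 2) =ᵐ[volume]
      fun ξ => (2 * Real.pi * Complex.I * (inner ℝ ξ v : ℝ)) • (𝓕 f : Lp (α := V) F 2) ξ := by
  rw [TemperedDistribution.lineDeriv_eq_fourierMultiplierCLM, ← smul_apply,
    ← fourierMultiplierCLM_smul (by fun_prop)]
  exact fourierMultiplierCLM_eq_iff (by fun_prop)

theorem inner_lineDeriv_eq_neg {v : V} {f f' g g' : Lp (α := V) F 2}
    (hf : ∂_{v} (f : 𝓢'(V, F)) = (f' : 𝓢'(V, F))) (hg : ∂_{v} (g : 𝓢'(V, F)) = (g' : 𝓢'(V, F))) :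
    (inner ℂ f g' : ℂ) = -inner ℂ f' g := by
  rw [← Lp.inner_fourier_eq, ← Lp.inner_fourier_eq f', L2.inner_def, L2.inner_def, ← integral_neg]
  refine integral_congr_ae ?_
  filter_upwards [lineDeriv_eq_iff_fourier.mp hf, lineDeriv_eq_iff_fourier.mp hg] with ξ hf' hg'
  rw [hf', hg', inner_smul_left, inner_smul_right]
  simp only [map_mul, Complex.conj_ofReal, Complex.conj_I, Complex.conj_ofNat]
  ring

end FourierL2

section Convolution

variable {G : Type*} [AddGroup G] [MeasurableSpace G] [MeasurableAdd₂ G] [MeasurableNeg G]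
  {μ : Measure G} [SFinite μ] [μ.IsAddLeftInvariant] {f g : G → ℝ≥0∞}

theorem rpow_lintegral_mul_le {α : Type*} [MeasurableSpace α] {ν : Measure α} {f g : α → ℝ≥0∞}
    (hf : AEMeasurable f ν) (hg : AEMeasurable g ν) {p : ℝ} (hp : 1 ≤ p) :
    (∫⁻ y, f y * g y ∂ν) ^ p ≤ (∫⁻ y, f y ∂ν) ^ (p - 1) * ∫⁻ y, f y * g y ^ p ∂ν := by
  have hp₀ : 0 < p := one_pos.trans_le hp
  have split_weight : ∀ y, f y * g y = f y ^ (1 - p⁻¹) * (f y * g y ^ p) ^ p⁻¹ := fun y => by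
    rw [ENNReal.mul_rpow_of_nonneg _ _ (by positivity), ← mul_assoc,
      ← ENNReal.rpow_add_of_nonneg _ _ (sub_nonneg.mpr (inv_le_one_of_one_le₀ hp)) (by positivity),
      sub_add_cancel, ENNReal.rpow_one, ENNReal.rpow_rpow_inv hp₀.ne']
  calc (∫⁻ y, f y * g y ∂ν) ^ p
      ≤ ((∫⁻ y, f y ∂ν) ^ (1 - p⁻¹) * (∫⁻ y, f y * g y ^ p ∂ν) ^ p⁻¹) ^ p := by
        simp only [split_weight]
        gcongr
        exact ENNReal.lintegral_mul_norm_pow_le hf (hf.mul (hg.pow_const p))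
          (sub_nonneg.mpr (inv_le_one_of_one_le₀ hp)) (by positivity) (sub_add_cancel _ _)
    _ = (∫⁻ y, f y ∂ν) ^ (p - 1) * ∫⁻ y, f y * g y ^ p ∂ν := by
        rw [ENNReal.mul_rpow_of_nonneg _ _ hp₀.le, ← ENNReal.rpow_mul,
          ENNReal.rpow_inv_rpow hp₀.ne', sub_mul, inv_mul_cancel₀ hp₀.ne', one_mul]

theorem lintegral_rpow_lconvolution_le (hf : AEMeasurable f μ) (hg : AEMeasurable g μ) {p : ℝ}
    (hp : 1 ≤ p) :
    ∫⁻ x, (f ⋆ₗ[μ] g) x ^ p ∂μ ≤ (∫⁻ y, f y ∂μ) ^ p * ∫⁻ y, g y ^ p ∂μ := by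
  calc ∫⁻ x, (f ⋆ₗ[μ] g) x ^ p ∂μ
      ≤ ∫⁻ x, (∫⁻ y, f y ∂μ) ^ (p - 1) * (f ⋆ₗ[μ] (g · ^ p)) x ∂μ := by
        refine lintegral_mono fun x => rpow_lintegral_mul_le hf ?_ hp
        fun_prop
    _ = (∫⁻ y, f y ∂μ) ^ (p - 1) * ∫⁻ x, ∫⁻ y, f y * g (-y + x) ^ p ∂μ ∂μ :=
        lintegral_const_mul'' _ (by fun_prop)
    _ = (∫⁻ y, f y ∂μ) ^ (p - 1) * ∫⁻ y, f y * ∫⁻ x, g x ^ p ∂μ ∂μ := by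
        rw [lintegral_lintegral_swap (by fun_prop)]
        congr 2 with y
        have hgy : AEMeasurable (fun x => g (-y + x)) μ := hg.comp_quasiMeasurePreserving
          (measurePreserving_add_left μ (-y)).quasiMeasurePreserving
        rw [lintegral_const_mul'' _ (hgy.pow_const p), lintegral_add_left_eq_self fun x => g x ^ p]
    _ = (∫⁻ y, f y ∂μ) ^ p * ∫⁻ y, g y ^ p ∂μ := by
        rw [lintegral_mul_const'' _ hf, ← mul_assoc]
        nth_rw 2 [← ENNReal.rpow_one (∫⁻ y, f y ∂μ)]
        rw [← ENNReal.rpow_add_of_nonneg _ _ (sub_nonneg.mpr hp) one_pos.le, sub_add_cancel]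

theorem eLpNorm_lconvolution_le (hf : AEMeasurable f μ) (hg : AEMeasurable g μ) {p : ℝ≥0∞}
    (hp : 1 ≤ p) (hp_top : p ≠ ∞) :
    eLpNorm (f ⋆ₗ[μ] g) p μ ≤ eLpNorm f 1 μ * eLpNorm g p μ := by
  have hp_pos : p ≠ 0 := (one_pos.trans_le hp).ne'
  have hp_real : 1 ≤ p.toReal := by simpa using ENNReal.toReal_mono hp_top hp
  have hp_real_pos : 0 < p.toReal := one_pos.trans_le hp_real
  simp only [eLpNorm_eq_lintegral_rpow_enorm_toReal hp_pos hp_top, eLpNorm_one_eq_lintegral_enorm,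
    enorm_eq_self]
  rw [one_div, ENNReal.rpow_inv_le_iff hp_real_pos, ENNReal.mul_rpow_of_nonneg _ _ hp_real_pos.le,
    ENNReal.rpow_inv_rpow hp_real_pos.ne']
  exact lintegral_rpow_lconvolution_le hf hg hp_real

end Convolution

section SobolevWeight

variable {V : Type*} [NormedAddCommGroup V] {s : ℝ} {ξ : V}

/-- The symbol `(1 + |ξ|²)^{s/2}` of the Bessel potential of order `s`. -/
def sobolevWeight (s : ℝ) (ξ : V) : ℝ := (1 + ‖ξ‖ ^ 2) ^ (s / 2)

theorem sobolevWeight_pos : 0 < sobolevWeight s ξ := by unfold sobolevWeight; positivity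

theorem one_le_sobolevWeight (hs : 0 ≤ s) : 1 ≤ sobolevWeight s ξ :=
  Real.one_le_rpow (by linarith [sq_nonneg ‖ξ‖]) (by linarith)

theorem norm_le_norm_sobolevWeight_smul {F : Type*} [NormedAddCommGroup F] [NormedSpace ℝ F]
    (hs : 0 ≤ s) (z : F) : ‖z‖ ≤ ‖sobolevWeight s ξ • z‖ := by
  rw [norm_smul, Real.norm_of_nonneg sobolevWeight_pos.le]
  exact le_mul_of_one_le_left (norm_nonneg z) (one_le_sobolevWeight hs)

@[simp]
theorem sobolevWeight_neg : sobolevWeight s (-ξ) = sobolevWeight s ξ := by simp [sobolevWeight]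

theorem sobolevWeight_neg_order_mul : sobolevWeight (-s) ξ * sobolevWeight s ξ = 1 := by
  unfold sobolevWeight
  rw [← Real.rpow_add (by positivity), neg_div, neg_add_cancel, Real.rpow_zero]

theorem continuous_sobolevWeight : Continuous (sobolevWeight s : V → ℝ) := by
  unfold sobolevWeight
  exact Continuous.rpow_const (by fun_prop) fun x => Or.inl (by positivity)

theorem sobolevWeight_add_le (hs : 0 ≤ s) (ξ η : V) :
    sobolevWeight s (ξ + η) ≤ 2 ^ s * (sobolevWeight s ξ + sobolevWeight s η) := by
  wlog hle : ‖η‖ ≤ ‖ξ‖ generalizing ξ η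
  · rw [add_comm ξ η, add_comm (sobolevWeight s ξ)]
    exact this η ξ (le_of_not_ge hle)
  have two_rpow : (2 : ℝ) ^ s = 4 ^ (s / 2) := by
    rw [show (4 : ℝ) = 2 ^ (2 : ℝ) by norm_num, ← Real.rpow_mul (by norm_num),
      mul_div_cancel₀ s two_ne_zero]
  calc sobolevWeight s (ξ + η) ≤ 2 ^ s * sobolevWeight s ξ := by
        unfold sobolevWeight
        rw [two_rpow, ← Real.mul_rpow (by norm_num) (by positivity)]
        refine Real.rpow_le_rpow (by positivity) ?_ (by linarith)
        nlinarith [norm_add_le ξ η, norm_nonneg ξ, norm_nonneg η, norm_nonneg (ξ + η)]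
    _ ≤ 2 ^ s * (sobolevWeight s ξ + sobolevWeight s η) := by
        gcongr
        exact le_add_of_nonneg_right sobolevWeight_pos.le

section Convolution

open scoped Convolution

variable [NormedSpace ℝ V] [MeasurableSpace V] [BorelSpace V]
  [FiniteDimensional ℝ V] {μ : Measure V} [μ.IsAddHaarMeasure] {f g : V → ℂ}

theorem enorm_convolution_mul_le {G : Type*} [AddCommGroup G] [MeasurableSpace G] (μ : Measure G)
    (f g : G → ℂ) (x : G) :
    ‖(f ⋆[ContinuousLinearMap.mul ℂ ℂ, μ] g) x‖ₑ ≤ ((‖f ·‖ₑ) ⋆ₗ[μ] (‖g ·‖ₑ)) x := by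
  rw [convolution_def]
  refine (enorm_integral_le_lintegral_enorm _).trans_eq ?_
  simp only [ContinuousLinearMap.mul_apply', enorm_mul, lconvolution_def, sub_eq_neg_add]

theorem enorm_sobolevWeight_smul_convolution_le (hs : 0 ≤ s)
    (hf : AEStronglyMeasurable f μ) (hg : AEStronglyMeasurable g μ) (ξ : V) :
    ‖sobolevWeight s ξ • (f ⋆[ContinuousLinearMap.mul ℂ ℂ, μ] g) ξ‖ₑ ≤
      ENNReal.ofReal (2 ^ s) * (((fun η => ‖sobolevWeight s η • f η‖ₑ) ⋆ₗ[μ] (‖g ·‖ₑ)) ξ +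
        ((‖f ·‖ₑ) ⋆ₗ[μ] fun η => ‖sobolevWeight s η • g η‖ₑ) ξ) := by
  have enorm_weight : ∀ η : V, ‖sobolevWeight s η‖ₑ = ENNReal.ofReal (sobolevWeight s η) :=
    fun η => Real.enorm_of_nonneg sobolevWeight_pos.le
  have weight_le : ∀ η, ‖sobolevWeight s ξ‖ₑ ≤
      ENNReal.ofReal (2 ^ s) * (‖sobolevWeight s η‖ₑ + ‖sobolevWeight s (-η + ξ)‖ₑ) := fun η => by
    simp only [enorm_weight]
    rw [← ENNReal.ofReal_add sobolevWeight_pos.le sobolevWeight_pos.le,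
      ← ENNReal.ofReal_mul (by positivity)]
    refine ENNReal.ofReal_le_ofReal ?_
    simpa using sobolevWeight_add_le hs η (-η + ξ)
  have := hf.enorm
  have := hg.enorm
  have hw : Continuous (sobolevWeight s : V → ℝ) := continuous_sobolevWeight
  have : AEMeasurable (fun η => ‖g (-η + ξ)‖ₑ) μ := by fun_prop
  simp only [enorm_smul]
  calc ‖sobolevWeight s ξ‖ₑ * ‖(f ⋆[ContinuousLinearMap.mul ℂ ℂ, μ] g) ξ‖ₑ
      ≤ ‖sobolevWeight s ξ‖ₑ * ∫⁻ η, ‖f η‖ₑ * ‖g (-η + ξ)‖ₑ ∂μ := by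
        gcongr
        exact enorm_convolution_mul_le μ f g ξ
    _ = ∫⁻ η, ‖sobolevWeight s ξ‖ₑ * (‖f η‖ₑ * ‖g (-η + ξ)‖ₑ) ∂μ :=
        (lintegral_const_mul'' _ (by fun_prop)).symm
    _ ≤ ∫⁻ η, ENNReal.ofReal (2 ^ s) * (‖sobolevWeight s η‖ₑ + ‖sobolevWeight s (-η + ξ)‖ₑ) *
          (‖f η‖ₑ * ‖g (-η + ξ)‖ₑ) ∂μ := by
        gcongr with η
        exact weight_le η
    _ = ∫⁻ η, ENNReal.ofReal (2 ^ s) * (‖sobolevWeight s η‖ₑ * ‖f η‖ₑ * ‖g (-η + ξ)‖ₑ +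
          ‖f η‖ₑ * (‖sobolevWeight s (-η + ξ)‖ₑ * ‖g (-η + ξ)‖ₑ)) ∂μ := by
        congr with η
        ring
    _ = _ := by
        rw [lintegral_const_mul' _ _ ENNReal.ofReal_ne_top, lintegral_add_left' (by fun_prop)]
        rfl

theorem eLpNorm_sobolevWeight_smul_convolution_le (hs : 0 ≤ s)
    (hf : AEStronglyMeasurable f μ) (hg : AEStronglyMeasurable g μ) {p : ℝ≥0∞} (hp : 1 ≤ p)
    (hp_top : p ≠ ∞) :
    eLpNorm (fun ξ => sobolevWeight s ξ • (f ⋆[ContinuousLinearMap.mul ℂ ℂ, μ] g) ξ) p μ ≤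
      ENNReal.ofReal (2 ^ s) *
        (eLpNorm (fun ξ => sobolevWeight s ξ • f ξ) p μ * eLpNorm g 1 μ +
          eLpNorm f 1 μ * eLpNorm (fun ξ => sobolevWeight s ξ • g ξ) p μ) := by
  set wf : V → ℝ≥0∞ := fun ξ => ‖sobolevWeight s ξ • f ξ‖ₑ
  set wg : V → ℝ≥0∞ := fun ξ => ‖sobolevWeight s ξ • g ξ‖ₑ
  have hf_enorm := hf.enorm
  have hg_enorm := hg.enorm
  have hw : Continuous (sobolevWeight s : V → ℝ) := continuous_sobolevWeight
  have hwf : AEMeasurable wf μ := by fun_prop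
  have hwg : AEMeasurable wg μ := by fun_prop
  calc eLpNorm (fun ξ => sobolevWeight s ξ • (f ⋆[ContinuousLinearMap.mul ℂ ℂ, μ] g) ξ) p μ
      ≤ ENNReal.ofReal (2 ^ s) * eLpNorm ((wf ⋆ₗ[μ] (‖g ·‖ₑ)) + ((‖f ·‖ₑ) ⋆ₗ[μ] wg)) p μ :=
        eLpNorm_le_mul_eLpNorm_of_ae_le_mul'' p (by fun_prop)
          (.of_forall fun ξ => enorm_sobolevWeight_smul_convolution_le hs hf hg ξ)
    _ ≤ ENNReal.ofReal (2 ^ s) *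
          (eLpNorm ((‖g ·‖ₑ) ⋆ₗ[μ] wf) p μ + eLpNorm ((‖f ·‖ₑ) ⋆ₗ[μ] wg) p μ) := by
        rw [lconvolution_comm]
        gcongr
        exact eLpNorm_add_le (by fun_prop) (by fun_prop) hp
    _ ≤ _ := by
        rw [mul_comm (eLpNorm _ p μ), ← eLpNorm_enorm g, ← eLpNorm_enorm f,
          ← eLpNorm_enorm fun ξ => sobolevWeight s ξ • f ξ,
          ← eLpNorm_enorm fun ξ => sobolevWeight s ξ • g ξ]
        gcongr
        · exact eLpNorm_lconvolution_le hg_enorm hwf hp hp_top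
        · exact eLpNorm_lconvolution_le hf_enorm hwg hp hp_top

end Convolution

end SobolevWeight

section SobolevSpace

section BesselPotential

variable {V F : Type*} [NormedAddCommGroup V] [InnerProductSpace ℝ V] [FiniteDimensional ℝ V]
  [MeasurableSpace V] [BorelSpace V] [NormedAddCommGroup F] [InnerProductSpace ℂ F]
  [CompleteSpace F]

theorem besselPotential_eq_iff_fourier {s : ℝ} {f g : Lp (α := V) F 2} :
    besselPotential V F s (f : 𝓢'(V, F)) = (g : 𝓢'(V, F)) ↔
      (𝓕 g : Lp (α := V) F 2) =ᵐ[volume]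
        fun ξ => sobolevWeight s ξ • (𝓕 f : Lp (α := V) F 2) ξ := by
  have hm : (fun ξ : V => (sobolevWeight s ξ : ℂ)).HasTemperateGrowth := by
    unfold sobolevWeight
    fun_prop
  simp only [← Complex.coe_smul]
  exact fourierMultiplierCLM_eq_iff hm

theorem memLp_sobolevWeight_neg_order {s : ℝ} (hs : Module.finrank ℝ V < 2 * s) :
    MemLp (sobolevWeight (-s) : V → ℝ) 2 := by
  rw [← integrable_norm_rpow_iff continuous_sobolevWeight.aestronglyMeasurable (by norm_num)
    (by norm_num)]
  refine (integrable_rpow_neg_one_add_norm_sq hs).congr (.of_forall fun ξ => ?_)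
  simp only [Real.norm_of_nonneg sobolevWeight_pos.le, ENNReal.toReal_ofNat]
  rw [sobolevWeight, ← Real.rpow_mul (by positivity)]
  congr 1
  ring

end BesselPotential

namespace Hs

variable {s : ℝ} (u v : Hs s)

theorem fourier_bessel :
    (𝓕 u.bessel : L2) =ᵐ[volume] fun ξ => sobolevWeight s ξ • (𝓕 u.toL2 : L2) ξ :=
  besselPotential_eq_iff_fourier.mp u.bessel_spec

theorem memLp_sobolevWeight_smul_fourier :
    MemLp (fun ξ => sobolevWeight s ξ • (𝓕 u.toL2 : L2) ξ) 2 :=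
  (Lp.memLp (𝓕 u.bessel : L2)).ae_eq u.fourier_bessel

theorem norm_eq_norm_bessel : ‖u‖ = ‖u.bessel‖ := rfl

theorem enorm_eq_eLpNorm :
    ‖u‖ₑ = eLpNorm (fun ξ => sobolevWeight s ξ • (𝓕 u.toL2 : L2) ξ) 2 volume := by
  rw [← eLpNorm_congr_ae u.fourier_bessel, ← Lp.enorm_def, ← ofReal_norm, ← ofReal_norm,
    Lp.norm_fourier_eq, norm_eq_norm_bessel]

theorem exists_of_integrable (hs : 0 ≤ s) {G : ℝ → ℂ} (hG : Integrable G)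
    (hwG : MemLp (fun ξ => sobolevWeight s ξ • G ξ) 2) :
    ∃ u : Hs s, u.toL2 =ᵐ[volume] 𝓕⁻ G ∧ (𝓕 u.toL2 : L2) =ᵐ[volume] G := by
  have hG₂ : MemLp G 2 := hwG.of_le hG.aestronglyMeasurable
    (.of_forall fun ξ => norm_le_norm_sobolevWeight_smul hs (G ξ))
  have hfourier : (𝓕 (𝓕⁻ hG₂.toLp : L2) : L2) =ᵐ[volume] G := by
    rw [FourierTransform.fourier_fourierInv_eq]
    exact hG₂.coeFn_toLp
  have hmem : MemSobolev s 2 ((𝓕⁻ hG₂.toLp : L2) : 𝓢'(ℝ, ℂ)) := by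
    refine ⟨𝓕⁻ hwG.toLp, besselPotential_eq_iff_fourier.mpr ?_⟩
    rw [FourierTransform.fourier_fourierInv_eq]
    filter_upwards [hwG.coeFn_toLp, hfourier] with ξ hξ hGξ
    rw [hξ, hGξ]
  refine ⟨⟨𝓕⁻ hG₂.toLp, hmem⟩,
    (coeFn_fourierInv_of_integrable (hG.congr hG₂.coeFn_toLp.symm)).trans (.of_forall fun x => ?_),
    hfourier⟩
  rw [Real.fourierInv_eq', Real.fourierInv_eq']
  refine integral_congr_ae ?_
  filter_upwards [hG₂.coeFn_toLp] with ξ hξ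
  rw [hξ]

theorem norm_toL2_le (hs : 0 ≤ s) : ‖u.toL2‖ ≤ ‖u‖ := by
  rw [u.norm_eq_norm_bessel, ← Lp.norm_fourier_eq, ← Lp.norm_fourier_eq u.bessel]
  refine Lp.norm_le_norm_of_ae_le ?_
  filter_upwards [u.fourier_bessel] with ξ hξ
  rw [hξ]
  exact norm_le_norm_sobolevWeight_smul hs _

/-- The inclusion of `H^s` in `L²` as a continuous linear map. -/
def toL2CLM (hs : 0 ≤ s) : Hs s →L[ℂ] L2 :=
  toL2.mkContinuous 1 fun u => by simpa only [one_mul] using u.norm_toL2_le hs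

theorem bessel_surjective (hs : 0 ≤ s) : Function.Surjective (bessel (s := s)) := by
  intro g
  have hmem : MemSobolev s 2 (besselPotential ℝ ℂ (-s) (g : 𝓢'(ℝ, ℂ))) := by
    rw [memSobolev_besselPotential_iff, neg_add_cancel]
    exact memSobolev_zero_iff.mpr ⟨g, rfl⟩
  obtain ⟨f, hf⟩ := memSobolev_zero_iff.mp (hmem.mono hs)
  exact ⟨⟨f, show MemSobolev s 2 (f : 𝓢'(ℝ, ℂ)) from hf ▸ hmem⟩,
    besselFun_eq _ ((besselPotential_neg_apply_eq_iff s _ _).mp hf)⟩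

theorem completeSpace (hs : 0 ≤ s) : CompleteSpace (Hs s) := by
  have isometry_bessel : Isometry (bessel (s := s)) :=
    AddMonoidHomClass.isometry_of_norm _ fun u => u.norm_eq_norm_bessel.symm
  exact (isometry_bessel.isUniformInducing.completeSpace_congr (bessel_surjective hs)).mpr
    inferInstance

section Algebra

/-- The norm of `(1 + |ξ|²)^{-s/2}` in `L²(ℝ)`, which bounds the `L¹` norm of `𝓕 u` by the norm of
`u` in `H^s`. It is infinite for `s ≤ 1/2`. -/
def fourierBound (s : ℝ) : ℝ≥0∞ := eLpNorm (sobolevWeight (-s) : ℝ → ℝ) 2 volume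

theorem eLpNorm_fourier_one_le : eLpNorm (𝓕 u.toL2 : L2) 1 volume ≤ fourierBound s * ‖u‖ₑ := by
  rw [u.enorm_eq_eLpNorm]
  refine (eLpNorm_congr_ae (.of_forall fun ξ => ?_)).trans_le (eLpNorm_smul_le_mul_eLpNorm
    (p := 2) (q := 2) (r := 1) u.memLp_sobolevWeight_smul_fourier.1
    continuous_sobolevWeight.aestronglyMeasurable)
  rw [Pi.smul_apply', smul_smul, sobolevWeight_neg_order_mul, one_smul]

theorem fourierBound_lt_top (hs : 1 / 2 < s) : fourierBound s < ∞ :=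
  (memLp_sobolevWeight_neg_order (by rw [Module.finrank_self]; push_cast; linarith)).2

theorem integrable_fourier (hs : 1 / 2 < s) : Integrable (𝓕 u.toL2 : L2) :=
  memLp_one_iff_integrable.mp ⟨Lp.aestronglyMeasurable _,
    u.eLpNorm_fourier_one_le.trans_lt (ENNReal.mul_lt_top (fourierBound_lt_top hs) enorm_lt_top)⟩

theorem coeFn_eq_fourierInv (hs : 1 / 2 < s) :
    u.toL2 =ᵐ[volume] 𝓕⁻ ((𝓕 u.toL2 : L2) : ℝ → ℂ) := by
  simpa only [FourierTransform.fourierInv_fourier_eq] using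
    coeFn_fourierInv_of_integrable (u.integrable_fourier hs)

open scoped Convolution in
theorem eLpNorm_sobolevWeight_smul_convolution_fourier_le (hs : 0 ≤ s) :
    eLpNorm (fun ξ => sobolevWeight s ξ •
      ((𝓕 u.toL2 : L2) ⋆[ContinuousLinearMap.mul ℂ ℂ] (𝓕 v.toL2 : L2)) ξ) 2 volume ≤
        2 * ENNReal.ofReal (2 ^ s) * fourierBound s * ‖u‖ₑ * ‖v‖ₑ := by
  calc _ ≤ ENNReal.ofReal (2 ^ s) * (‖u‖ₑ * eLpNorm (𝓕 v.toL2 : L2) 1 volume +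
        eLpNorm (𝓕 u.toL2 : L2) 1 volume * ‖v‖ₑ) := by
        rw [u.enorm_eq_eLpNorm, v.enorm_eq_eLpNorm]
        exact eLpNorm_sobolevWeight_smul_convolution_le hs (Lp.aestronglyMeasurable _)
          (Lp.aestronglyMeasurable _) one_le_two ENNReal.ofNat_ne_top
    _ ≤ ENNReal.ofReal (2 ^ s) * (‖u‖ₑ * (fourierBound s * ‖v‖ₑ) +
        fourierBound s * ‖u‖ₑ * ‖v‖ₑ) := by
        gcongr
        exacts [v.eLpNorm_fourier_one_le, u.eLpNorm_fourier_one_le]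
    _ = 2 * ENNReal.ofReal (2 ^ s) * fourierBound s * ‖u‖ₑ * ‖v‖ₑ := by ring

open scoped Convolution in
theorem exists_mul (hs : 1 / 2 < s) :
    ∃ p : Hs s, p.toL2 =ᵐ[volume] (fun x => u.toL2 x * v.toL2 x) ∧
      ‖p‖ ≤ 2 * 2 ^ s * (fourierBound s).toReal * ‖u‖ * ‖v‖ := by
  have hs₀ : 0 ≤ s := by linarith
  have hu := u.integrable_fourier hs
  have hv := v.integrable_fourier hs
  have hint : Integrable ((𝓕 u.toL2 : L2) ⋆[ContinuousLinearMap.mul ℂ ℂ] (𝓕 v.toL2 : L2)) :=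
    hu.integrable_convolution (ContinuousLinearMap.mul ℂ ℂ) hv
  have hbound := eLpNorm_sobolevWeight_smul_convolution_fourier_le u v hs₀
  have hbound_lt_top := fourierBound_lt_top hs
  obtain ⟨p, hp, hp_fourier⟩ := exists_of_integrable hs₀ hint
    ⟨continuous_sobolevWeight.aestronglyMeasurable.smul hint.aestronglyMeasurable,
      hbound.trans_lt (by finiteness)⟩
  refine ⟨p, ?_, ?_⟩
  · filter_upwards [hp, u.coeFn_eq_fourierInv hs, v.coeFn_eq_fourierInv hs] with x hpx hux hvx
    rw [hpx, hux, hvx, Real.fourierInv_eq_fourier_neg, Real.fourierInv_eq_fourier_neg,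
      Real.fourierInv_eq_fourier_neg, Real.fourier_mul_convolution_eq hu hv]
  · have henorm : ‖p‖ₑ ≤ 2 * ENNReal.ofReal (2 ^ s) * fourierBound s * ‖u‖ₑ * ‖v‖ₑ := by
      rw [p.enorm_eq_eLpNorm]
      refine (eLpNorm_congr_ae ?_).trans_le hbound
      filter_upwards [hp_fourier] with ξ hξ
      rw [hξ]
    have hreal := ENNReal.toReal_mono (by finiteness) henorm
    simpa only [ENNReal.toReal_mul, toReal_enorm, ENNReal.toReal_ofNat,
      ENNReal.toReal_ofReal (show (0 : ℝ) ≤ 2 ^ s by positivity)] using hreal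

theorem exists_conj (hs : 1 / 2 < s) :
    ∃ p : Hs s, p.toL2 =ᵐ[volume] (fun x => (starRingEnd ℂ) (u.toL2 x)) ∧ ‖p‖ = ‖u‖ := by
  set F : ℝ → ℂ := ((𝓕 u.toL2 : L2) : ℝ → ℂ) with hF
  set G : ℝ → ℂ := fun ξ => (starRingEnd ℂ) (F (-ξ)) with hG
  have hint : Integrable G :=
    Complex.conjCLE.toContinuousLinearMap.integrable_comp (u.integrable_fourier hs).comp_neg
  have hnorm : eLpNorm (fun ξ => sobolevWeight s ξ • G ξ) 2 volume =
      eLpNorm (fun ξ => sobolevWeight s ξ • F ξ) 2 volume := by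
    rw [← eLpNorm_comp_measurePreserving u.memLp_sobolevWeight_smul_fourier.1
      (Measure.measurePreserving_neg volume)]
    refine eLpNorm_congr_norm_ae (.of_forall fun ξ => ?_)
    simp only [hG, hF, Function.comp_apply, norm_smul, RCLike.norm_conj, sobolevWeight_neg]
  obtain ⟨p, hp, hp_fourier⟩ := exists_of_integrable (by linarith) hint
    ⟨continuous_sobolevWeight.aestronglyMeasurable.smul hint.aestronglyMeasurable,
      hnorm ▸ u.memLp_sobolevWeight_smul_fourier.2⟩
  refine ⟨p, ?_, ?_⟩
  · filter_upwards [hp, u.coeFn_eq_fourierInv hs] with x hpx hux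
    rw [hpx, hux, Real.fourierInv_eq', Real.fourierInv_eq', ← integral_conj, ← integral_neg_eq_self]
    congr with ξ
    simp [hG, ← Complex.exp_conj, hF, Complex.conj_ofNat]
  · have henorm : ‖p‖ₑ = ‖u‖ₑ := by
      rw [p.enorm_eq_eLpNorm, u.enorm_eq_eLpNorm, ← hF, ← hnorm]
      refine eLpNorm_congr_ae ?_
      filter_upwards [hp_fourier] with ξ hξ
      rw [hξ]
    simpa only [toReal_enorm] using congrArg ENNReal.toReal henorm

end Algebra

end Hs

end SobolevSpace

section PointwiseLimits

open Filter Topology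

variable {X E : Type*} [MeasurableSpace X] {μ : Measure X} [NormedAddCommGroup E] {p : ℝ≥0∞}
  [Fact (1 ≤ p)]

theorem coeFn_ae_eq_of_tendsto {f : ℕ → Lp E p μ} {g : Lp E p μ} {F : ℕ → X → E} {G : X → E}
    (hfg : Tendsto f atTop (𝓝 g)) (hF : ∀ n, f n =ᵐ[μ] F n)
    (hFG : ∀ᵐ x ∂μ, Tendsto (fun n => F n x) atTop (𝓝 (G x))) : g =ᵐ[μ] G := by
  obtain ⟨ns, hns, hlim⟩ := (tendstoInMeasure_of_tendsto_Lp hfg).exists_seq_tendsto_ae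
  filter_upwards [hlim, hFG, ae_all_iff.mpr hF] with x hlimx hFGx hFx
  refine tendsto_nhds_unique hlimx ?_
  simp only [hFx]
  exact hFGx.comp hns.tendsto_atTop

theorem coeFn_ae_eq_of_hasDerivAt [NormedSpace ℝ E] {c : ℝ → Lp E p μ} {d : Lp E p μ} {t : ℝ}
    {F : X → ℝ → E} {F' : X → E} (hc : HasDerivAt c d t) (hF : ∀ r, c r =ᵐ[μ] fun x => F x r)
    (hF' : ∀ᵐ x ∂μ, HasDerivAt (F x) (F' x) t) : d =ᵐ[μ] F' := by
  obtain ⟨r, hr⟩ := exists_seq_tendsto (𝓝[≠] t)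
  refine coeFn_ae_eq_of_tendsto ((hasDerivAt_iff_tendsto_slope.mp hc).comp hr)
    (F := fun n x => slope (F x) t (r n)) (fun n => ?_) ?_
  · simp only [Function.comp_apply, slope_def_module]
    filter_upwards [Lp.coeFn_smul (r n - t)⁻¹ (c (r n) - c t), Lp.coeFn_sub (c (r n)) (c t), hF t,
      hF (r n)] with x hsmul hsub hFt hFr
    rw [hsmul, Pi.smul_apply, hsub, Pi.sub_apply, hFt, hFr]
  · filter_upwards [hF'] with x hx
    exact (hasDerivAt_iff_tendsto_slope.mp hx).comp hr

end PointwiseLimits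

section MultiplicationOperators

namespace Hs

variable {s : ℝ}

theorem ext_ae {u v : Hs s} (h : u.toL2 =ᵐ[volume] v.toL2) : u = v :=
  toL2_injective (Lp.ext h)

theorem coeFn_add (u v : Hs s) : (u + v).toL2 =ᵐ[volume] fun x => u.toL2 x + v.toL2 x := by
  rw [map_add]
  exact Lp.coeFn_add _ _

theorem coeFn_smul (c : ℂ) (u : Hs s) : (c • u).toL2 =ᵐ[volume] fun x => c * u.toL2 x := by
  rw [map_smul]
  exact Lp.coeFn_smul _ _

theorem toL2_add_real_smul (u h : Hs s) (t : ℝ) : (u + t • h).toL2 = u.toL2 + t • h.toL2 := by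
  rw [map_add]
  exact congrArg _ (map_smul (toL2.restrictScalars ℝ) t h)

theorem coeFn_add_real_smul (u h : Hs s) (t : ℝ) :
    (u + t • h).toL2 =ᵐ[volume] fun x => u.toL2 x + t • h.toL2 x := by
  rw [toL2_add_real_smul]
  filter_upwards [Lp.coeFn_add u.toL2 (t • h.toL2), Lp.coeFn_smul t h.toL2] with x hadd hsmul
  rw [hadd, Pi.add_apply, hsmul, Pi.smul_apply]

theorem exists_mulCLM (hs : 1 / 2 < s) : ∃ M : Hs s →L[ℂ] Hs s →L[ℂ] Hs s,
    ∀ u v, (M u v).toL2 =ᵐ[volume] fun x => u.toL2 x * v.toL2 x := by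
  choose m hm hm_norm using fun u v : Hs s => exists_mul u v hs
  refine ⟨LinearMap.mkContinuous₂ (LinearMap.mk₂ ℂ m ?_ ?_ ?_ ?_) _ hm_norm, hm⟩ <;>
    intros <;> apply ext_ae
  · filter_upwards [hm _ _, coeFn_add _ _, coeFn_add _ _, hm _ _, hm _ _] with x h₁ h₂ h₃ h₄ h₅
    rw [h₁, h₂, h₃, h₄, h₅, add_mul]
  · filter_upwards [hm _ _, coeFn_smul _ _, coeFn_smul _ _, hm _ _] with x h₁ h₂ h₃ h₄
    rw [h₁, h₂, h₃, h₄, mul_assoc]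
  · filter_upwards [hm _ _, coeFn_add _ _, coeFn_add _ _, hm _ _, hm _ _] with x h₁ h₂ h₃ h₄ h₅
    rw [h₁, h₂, h₃, h₄, h₅, mul_add]
  · filter_upwards [hm _ _, coeFn_smul _ _, coeFn_smul _ _, hm _ _] with x h₁ h₂ h₃ h₄
    rw [h₁, h₂, h₃, h₄, mul_left_comm]

theorem exists_conjCLM (hs : 1 / 2 < s) : ∃ C : Hs s →L[ℝ] Hs s,
    ∀ u, (C u).toL2 =ᵐ[volume] fun x => (starRingEnd ℂ) (u.toL2 x) := by
  choose c hc hc_norm using fun u : Hs s => u.exists_conj hs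
  refine ⟨LinearMap.mkContinuous
    { toFun := c, map_add' := fun u v => ext_ae ?_, map_smul' := fun a u => ext_ae ?_ } 1
    fun u => by rw [one_mul]; exact (hc_norm u).le, hc⟩
  · filter_upwards [hc (u + v), coeFn_add u v, coeFn_add (c u) (c v), hc u, hc v]
      with x h₁ h₂ h₃ h₄ h₅
    rw [h₁, h₂, h₃, h₄, h₅, map_add]
  · filter_upwards [hc ((a : ℂ) • u), coeFn_smul a u, coeFn_smul a (c u), hc u] with x h₁ h₂ h₃ h₄
    exact h₁.trans (by rw [h₂, map_mul, Complex.conj_ofReal, ← h₄, ← h₃]; rfl)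

/-- The pointwise product on `H^s`, as a continuous bilinear map. -/
def mul (hs : 1 / 2 < s) : Hs s →L[ℂ] Hs s →L[ℂ] Hs s := (exists_mulCLM hs).choose

theorem coeFn_mul (hs : 1 / 2 < s) (u v : Hs s) :
    (mul hs u v).toL2 =ᵐ[volume] fun x => u.toL2 x * v.toL2 x :=
  (exists_mulCLM hs).choose_spec u v

/-- Pointwise complex conjugation on `H^s`, as a continuous real linear map. -/
def conj (hs : 1 / 2 < s) : Hs s →L[ℝ] Hs s := (exists_conjCLM hs).choose

theorem coeFn_conj (hs : 1 / 2 < s) (u : Hs s) :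
    (conj hs u).toL2 =ᵐ[volume] fun x => (starRingEnd ℂ) (u.toL2 x) :=
  (exists_conjCLM hs).choose_spec u

theorem hasDerivAt_toL2_line (hs : 0 ≤ s) {Φ : Hs s → Hs s} {u : Hs s}
    (hΦ : DifferentiableAt ℝ Φ u) (h : Hs s) :
    HasDerivAt (fun t : ℝ => (Φ (u + t • h)).toL2) (fderiv ℝ Φ u h).toL2 0 :=
  ((toL2CLM hs).restrictScalars ℝ).hasFDerivAt.comp_hasDerivAt 0
    (hΦ.hasFDerivAt.hasLineDerivAt h)

theorem coeFn_fderiv_of_superposition (hs : 0 ≤ s) {Φ : Hs s → Hs s} {F : ℂ → ℂ}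
    (hΦF : ∀ v, (Φ v).toL2 =ᵐ[volume] fun x => F (v.toL2 x)) (hF : Differentiable ℝ F) {u : Hs s}
    (hΦ : DifferentiableAt ℝ Φ u) (h : Hs s) :
    (fderiv ℝ Φ u h).toL2 =ᵐ[volume] fun x => fderiv ℝ F (u.toL2 x) (h.toL2 x) := by
  refine coeFn_ae_eq_of_hasDerivAt (hasDerivAt_toL2_line hs hΦ h)
    (F := fun x t => F (u.toL2 x + t • h.toL2 x)) (fun t => ?_)
    (.of_forall fun x => (hF _).hasFDerivAt.hasLineDerivAt _)
  filter_upwards [hΦF (u + t • h), coeFn_add_real_smul u h t] with x hΦx hlinex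
  rw [hΦx, hlinex]

end Hs

/-- The operator `A` on `H^s` is the multiplication by the function `a`. -/
def IsMultiplicationBy {s : ℝ} (A : Hs s →L[ℂ] Hs s) (a : ℝ → ℂ) : Prop :=
  ∀ v, (A v).toL2 =ᵐ[volume] fun x => a x * v.toL2 x

namespace IsMultiplicationBy

variable {s : ℝ} {A B : Hs s →L[ℂ] Hs s} {a b : ℝ → ℂ}

theorem one : IsMultiplicationBy (1 : Hs s →L[ℂ] Hs s) fun _ => 1 := fun v => by
  simp only [one_apply_eq_self, one_mul]
  rfl

theorem mul (hA : IsMultiplicationBy A a) (hB : IsMultiplicationBy B b) :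
    IsMultiplicationBy (A * B) fun x => a x * b x := fun v => by
  filter_upwards [hA (B v), hB v] with x hAx hBx
  rw [mul_apply_eq_comp, hAx, hBx, mul_assoc]

theorem pow (hA : IsMultiplicationBy A a) (n : ℕ) :
    IsMultiplicationBy (A ^ n) fun x => a x ^ n := by
  induction n with
  | zero => simpa only [pow_zero] using one
  | succ n ih => simpa only [pow_succ] using ih.mul hA

theorem smul (hA : IsMultiplicationBy A a) (c : ℂ) :
    IsMultiplicationBy (c • A) fun x => c * a x := fun v => by
  filter_upwards [hA v, Hs.coeFn_smul c (A v)] with x hAx hsmul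
  rw [_root_.smul_apply, hsmul, hAx, mul_assoc]

theorem sum_range {A : ℕ → Hs s →L[ℂ] Hs s} {a : ℕ → ℝ → ℂ}
    (hA : ∀ i, IsMultiplicationBy (A i) (a i)) (n : ℕ) :
    IsMultiplicationBy (∑ i ∈ Finset.range n, A i) fun x => ∑ i ∈ Finset.range n, a i x := by
  intro v
  induction n with
  | zero =>
    simp only [Finset.range_zero, Finset.sum_empty, zero_apply, map_zero, zero_mul]
    exact Lp.coeFn_zero _ _ _
  | succ n ih =>
    filter_upwards [ih, hA n v, Hs.coeFn_add ((∑ i ∈ Finset.range n, A i) v) (A n v)]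
      with x hsum hn hadd
    rw [Finset.sum_range_succ, Finset.sum_range_succ, add_apply, hadd, hsum, hn, add_mul]

theorem exp (hs : 0 ≤ s) (hA : IsMultiplicationBy A a) :
    IsMultiplicationBy (NormedSpace.exp A) fun x => Complex.exp (a x) := by
  intro v
  have := Hs.completeSpace hs
  have hseries := ((Hs.toL2CLM hs).comp (ContinuousLinearMap.apply ℂ (Hs s) v)).hasSum
    (NormedSpace.exp_series_hasSum_exp' (𝕂 := ℂ) A)
  refine coeFn_ae_eq_of_tendsto hseries.tendsto_sum_nat (fun n => ?_)
    (.of_forall fun x => (((NormedSpace.exp_series_hasSum_exp' (𝕂 := ℂ) (a x)).tendsto_sum_nat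
      ).mul_const (v.toL2 x)).trans (by rw [Complex.exp_eq_exp_ℂ]))
  rw [← map_sum]
  exact IsMultiplicationBy.sum_range (fun i => (hA.pow i).smul _) n v

end IsMultiplicationBy

end MultiplicationOperators

section RadialMaps

variable {g : ℝ → ℂ}

theorem hasFDerivAt_radial_mul (hg : Differentiable ℝ g) (z : ℂ) :
    HasFDerivAt (fun z : ℂ => g (‖z‖ ^ 2) * z)
      (g (‖z‖ ^ 2) • ContinuousLinearMap.id ℝ ℂ +
        ((2 : ℝ) • innerSL ℝ z).smulRight (deriv g (‖z‖ ^ 2) * z)) z := by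
  have hg_norm_sq := (hg (‖z‖ ^ 2)).hasFDerivAt.comp z
    (hasStrictFDerivAt_norm_sq z).hasFDerivAt
  refine (hg_norm_sq.mul (hasFDerivAt_id z)).congr_fderiv (ContinuousLinearMap.ext fun k => ?_)
  simp only [id_eq, add_apply, smul_apply, ContinuousLinearMap.id_apply, smul_eq_mul,
    ContinuousLinearMap.comp_apply, Function.comp_apply, fderiv_eq_smul_deriv, Complex.real_smul,
    ContinuousLinearMap.smulRight_apply, nsmul_eq_mul, Nat.cast_ofNat, Complex.ofReal_mul,
    Complex.ofReal_ofNat]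
  ring

theorem differentiable_radial_mul (hg : Differentiable ℝ g) :
    Differentiable ℝ fun z : ℂ => g (‖z‖ ^ 2) * z :=
  fun z => (hasFDerivAt_radial_mul hg z).differentiableAt

theorem fderiv_radial_mul (hg : Differentiable ℝ g) (z k : ℂ) :
    fderiv ℝ (fun z : ℂ => g (‖z‖ ^ 2) * z) z k =
      g (‖z‖ ^ 2) * k + (2 * inner ℝ z k) • (deriv g (‖z‖ ^ 2) * z) := by
  rw [(hasFDerivAt_radial_mul hg z).fderiv]
  rfl

/-- `Im (conj h * k)` is the area form of the plane. -/
theorem im_conj_fderiv_radial_phase_mul {ψ : ℝ → ℝ} (hψ : Differentiable ℝ ψ) (z h k : ℂ) :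
    ((starRingEnd ℂ) (fderiv ℝ (fun z : ℂ => Complex.exp (Complex.I * ψ (‖z‖ ^ 2)) * z) z h) *
      fderiv ℝ (fun z : ℂ => Complex.exp (Complex.I * ψ (‖z‖ ^ 2)) * z) z k).im =
      ((starRingEnd ℂ) h * k).im := by
  set g : ℝ → ℂ := fun r => Complex.exp (Complex.I * ψ r) with hg_def
  have hderiv (r : ℝ) : HasDerivAt g (g r * (Complex.I * deriv ψ r)) r :=
    (((hψ r).hasDerivAt.ofReal_comp).const_mul Complex.I).cexp
  have hg : Differentiable ℝ g := fun r => (hderiv r).differentiableAt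
  have hunit : (starRingEnd ℂ) (g (‖z‖ ^ 2)) * g (‖z‖ ^ 2) = 1 := by
    rw [hg_def, ← Complex.exp_conj, ← Complex.exp_add]
    simp
  rw [fderiv_radial_mul hg, fderiv_radial_mul hg, (hderiv _).deriv]
  generalize deriv ψ (‖z‖ ^ 2) = c
  calc _ = ((starRingEnd ℂ) (g (‖z‖ ^ 2)) * g (‖z‖ ^ 2) *
        ((starRingEnd ℂ) (h + (2 * inner ℝ z h) • (Complex.I * c * z)) *
          (k + (2 * inner ℝ z k) • (Complex.I * c * z)))).im := by
        congr 1
        simp only [map_add, map_mul, Complex.real_smul]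
        ring
    _ = ((starRingEnd ℂ) h * k).im := by
        rw [hunit, one_mul]
        simp only [Complex.inner, Complex.real_smul, map_add, map_mul, Complex.conj_ofReal,
          Complex.conj_I, Complex.mul_re, Complex.mul_im, Complex.add_re, Complex.add_im,
          Complex.neg_re, Complex.neg_im, Complex.conj_re, Complex.conj_im, Complex.ofReal_re,
          Complex.ofReal_im, Complex.I_re, Complex.I_im]
        ring

theorem inner_fderiv_norm_sq_pow_mul (σ : ℕ) (z h : ℂ) :
    inner ℝ z (fderiv ℝ (fun z : ℂ => (((‖z‖ ^ 2) ^ σ : ℝ) : ℂ) * z) z h) +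
      inner ℝ h ((((‖z‖ ^ 2) ^ σ : ℝ) : ℂ) * z) =
      (2 * (σ : ℝ) + 2) * inner ℝ ((((‖z‖ ^ 2) ^ σ : ℝ) : ℂ) * z) h := by
  have hderiv (r : ℝ) :
      HasDerivAt (fun r : ℝ => ((r ^ σ : ℝ) : ℂ)) ((σ * r ^ (σ - 1) : ℝ) : ℂ) r :=
    (hasDerivAt_pow σ r).ofReal_comp
  have hpow (r : ℝ) : (σ : ℝ) * r ^ (σ - 1) * r = σ * r ^ σ := by
    cases σ with
    | zero => simp
    | succ σ => rw [Nat.add_sub_cancel, mul_assoc, pow_succ]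
  rw [fderiv_radial_mul (g := fun r => ((r ^ σ : ℝ) : ℂ)) (fun r => (hderiv r).differentiableAt),
    (hderiv _).deriv]
  have hsmul (c : ℝ) (w : ℂ) : (c : ℂ) * w = c • w := (Complex.real_smul ..).symm
  simp only [hsmul, inner_add_right, real_inner_smul_left, real_inner_smul_right,
    real_inner_self_eq_norm_sq, real_inner_comm z h]
  linear_combination 2 * inner ℝ z h * hpow (‖z‖ ^ 2)

end RadialMaps

section NonlinearStep

theorem coeFn_phaseMul (θ : ℝ → ℝ) (hθ : AEMeasurable θ) (f : L2) :
    phaseMul θ hθ f =ᵐ[volume] fun x => Complex.exp (Complex.I * (θ x : ℂ)) * f x :=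
  (memLp_phase θ hθ f).coeFn_toLp

theorem coeFn_nlStep (σ : ℕ) (τ : ℝ) (f : L2) :
    nlStep σ τ f =ᵐ[volume]
      fun x => Complex.exp (Complex.I * ((τ * ‖f x‖ ^ (2 * σ) : ℝ) : ℂ)) * f x :=
  coeFn_phaseMul _ _ f

theorem hasVariationalDerivative_iff_inner {H : L2 → ℝ} {u g : L2} :
    HasVariationalDerivative H u g ↔ ∀ φ : 𝓢(ℝ, ℂ),
      HasDerivAt (fun ε : ℝ => H (u + ε • φ.toLp 2 (volume : Measure ℝ)))
        (inner ℝ g (φ.toLp 2 (volume : Measure ℝ))) 0 := by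
  refine forall_congr' fun φ => ?_
  rw [L2.inner_def]
  refine Eq.to_iff (congrArg (HasDerivAt _ · 0) (integral_congr_ae ?_))
  filter_upwards [φ.coeFn_toLp 2 volume] with x hφx
  rw [hφx, Complex.inner, Complex.mul_re, Complex.conj_re, Complex.conj_im]
  ring

theorem differentiable_apply_restrictScalars {G E F : Type*} [NormedAddCommGroup G]
    [NormedSpace ℝ G] [NormedAddCommGroup E] [NormedSpace ℂ E] [NormedAddCommGroup F]
    [NormedSpace ℂ F] {A : G → E →L[ℂ] F} {f : G → E} (hA : Differentiable ℝ A)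
    (hf : Differentiable ℝ f) : Differentiable ℝ fun u => A u (f u) :=
  ((ContinuousLinearMap.restrictScalarsL ℂ E F ℝ ℝ).differentiable.comp hA).clm_apply hf

variable {s : ℝ} (hs : 1 / 2 < s) (σ : ℕ)

/-- Multiplication by `|u|^{2σ} = (u ū)^σ`, as an operator on `H^s`. -/
def modPowMul (u : Hs s) : Hs s →L[ℂ] Hs s := Hs.mul hs (Hs.mul hs u (Hs.conj hs u)) ^ σ

/-- The nonlinear substep `u ↦ exp(i τ |u|^{2σ}) u` on `H^s`, through the exponential series of
the multiplication by `|u|^{2σ}`. -/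
def nlStepHs (τ : ℝ) (u : Hs s) : Hs s :=
  NormedSpace.exp (τ • (Complex.I • modPowMul hs σ u)) u

theorem isMultiplicationBy_modPowMul (u : Hs s) :
    IsMultiplicationBy (modPowMul hs σ u) fun x => ((‖u.toL2 x‖ ^ (2 * σ) : ℝ) : ℂ) := by
  intro v
  have hmul : IsMultiplicationBy (Hs.mul hs (Hs.mul hs u (Hs.conj hs u)))
      (Hs.mul hs u (Hs.conj hs u)).toL2 := Hs.coeFn_mul hs _
  filter_upwards [hmul.pow σ v, Hs.coeFn_mul hs u (Hs.conj hs u), Hs.coeFn_conj hs u]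
    with x hpow hnormSq hconj
  rw [modPowMul, hpow, hnormSq, hconj, Complex.mul_conj, Complex.normSq_eq_norm_sq,
    ← Complex.ofReal_pow, pow_mul]

theorem isMultiplicationBy_exp_modPowMul (τ : ℝ) (u : Hs s) :
    IsMultiplicationBy (NormedSpace.exp (τ • (Complex.I • modPowMul hs σ u)))
      fun x => Complex.exp (Complex.I * ((τ * ‖u.toL2 x‖ ^ (2 * σ) : ℝ) : ℂ)) := by
  have hexp := (((isMultiplicationBy_modPowMul hs σ u).smul Complex.I).smul (τ : ℂ)).exp
    (by linarith)
  simpa only [Complex.coe_smul, Complex.ofReal_mul, mul_left_comm] using hexp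

theorem toL2_nlStepHs (τ : ℝ) (u : Hs s) : (nlStepHs hs σ τ u).toL2 = nlStep σ τ u.toL2 :=
  Lp.ext ((isMultiplicationBy_exp_modPowMul hs σ τ u u).trans (coeFn_nlStep σ τ u.toL2).symm)

theorem differentiable_modPowMul : Differentiable ℝ (modPowMul hs σ) := by
  have hmul : Differentiable ℝ (Hs.mul hs) := (Hs.mul hs).differentiable.restrictScalars ℝ
  exact (hmul.comp
    (differentiable_apply_restrictScalars hmul (Hs.conj hs).differentiable)).fun_pow σ

theorem differentiable_nlStepHs (τ : ℝ) : Differentiable ℝ (nlStepHs hs σ τ) := by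
  have := Hs.completeSpace (show 0 ≤ s by linarith)
  have hexp : Differentiable ℝ (NormedSpace.exp : (Hs s →L[ℂ] Hs s) → _) := fun A =>
    (NormedSpace.exp_analytic (𝕂 := ℂ) A).differentiableAt.restrictScalars ℝ
  exact differentiable_apply_restrictScalars
    (hexp.comp (((differentiable_modPowMul hs σ).const_smul Complex.I).const_smul τ))
    differentiable_id

theorem symplecticForm_eq_integral_im (f g : L2) :
    symplecticForm f g = ∫ x, ((starRingEnd ℂ) (f x) * g x).im := by
  refine integral_congr_ae (.of_forall fun x => ?_)
  simp only [Complex.mul_im, Complex.conj_re, Complex.conj_im]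
  ring

theorem symplecticForm_fderiv_nlStepHs (τ : ℝ) (u h k : Hs s) :
    symplecticForm (fderiv ℝ (nlStepHs hs σ τ) u h).toL2 (fderiv ℝ (nlStepHs hs σ τ) u k).toL2 =
      symplecticForm h.toL2 k.toL2 := by
  have hψ : Differentiable ℝ fun r : ℝ => τ * r ^ σ := by fun_prop
  have hfderiv (h : Hs s) := Hs.coeFn_fderiv_of_superposition (by linarith)
    (F := fun z => Complex.exp (Complex.I * ((τ * (‖z‖ ^ 2) ^ σ : ℝ) : ℂ)) * z)
    (fun v => by simpa only [← pow_mul, toL2_nlStepHs] using coeFn_nlStep σ τ v.toL2)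
    (differentiable_radial_mul (g := fun r => Complex.exp (Complex.I * ((τ * r ^ σ : ℝ) : ℂ)))
      (by fun_prop)) (differentiable_nlStepHs hs σ τ u) h
  rw [symplecticForm_eq_integral_im, symplecticForm_eq_integral_im]
  refine integral_congr_ae ?_
  filter_upwards [hfderiv h, hfderiv k] with x hh hk
  rw [hh, hk]
  exact im_conj_fderiv_radial_phase_mul hψ _ _ _

theorem differentiable_modPowMul_self : Differentiable ℝ fun u : Hs s => modPowMul hs σ u u :=
  differentiable_apply_restrictScalars (differentiable_modPowMul hs σ) differentiable_id

theorem coeFn_fderiv_modPowMul_self (u h : Hs s) :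
    (fderiv ℝ (fun u : Hs s => modPowMul hs σ u u) u h).toL2 =ᵐ[volume]
      fun x => fderiv ℝ (fun z : ℂ => (((‖z‖ ^ 2) ^ σ : ℝ) : ℂ) * z) (u.toL2 x) (h.toL2 x) :=
  Hs.coeFn_fderiv_of_superposition (by linarith)
    (fun v => by simpa only [← pow_mul] using isMultiplicationBy_modPowMul hs σ v v)
    (differentiable_radial_mul (g := fun r => ((r ^ σ : ℝ) : ℂ)) (by fun_prop))
    (differentiable_modPowMul_self hs σ u) h

theorem energyH2_eq_inner (u : Hs s) :
    energyH2 σ u.toL2 =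
      1 / (2 * (σ : ℝ) + 2) * inner ℝ u.toL2 (modPowMul hs σ u u).toL2 := by
  rw [energyH2, L2.inner_def]
  congr 1
  refine integral_congr_ae ?_
  filter_upwards [isMultiplicationBy_modPowMul hs σ u u] with x hx
  rw [hx, ← Complex.real_smul, real_inner_smul_right, real_inner_self_eq_norm_sq, pow_add]

theorem inner_fderiv_modPowMul_self (u h : Hs s) :
    inner ℝ u.toL2 (fderiv ℝ (fun u : Hs s => modPowMul hs σ u u) u h).toL2 +
        inner ℝ h.toL2 (modPowMul hs σ u u).toL2 =
      (2 * (σ : ℝ) + 2) * inner ℝ (modPowMul hs σ u u).toL2 h.toL2 := by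
  simp only [L2.inner_def]
  rw [← integral_add (L2.integrable_inner _ _) (L2.integrable_inner _ _), ← integral_const_mul]
  refine integral_congr_ae ?_
  filter_upwards [isMultiplicationBy_modPowMul hs σ u u, coeFn_fderiv_modPowMul_self hs σ u h]
    with x hx hfderiv
  rw [hx, hfderiv, pow_mul, inner_fderiv_norm_sq_pow_mul]

/-- A Schwartz function as an element of `H^s`. -/
def Hs.ofSchwartz (s : ℝ) (φ : 𝓢(ℝ, ℂ)) : Hs s :=
  ⟨φ.toLp 2 (volume : Measure ℝ), show MemSobolev s 2 _ from
    (Lp.toTemperedDistribution_toLp_eq (p := 2) (μ := (volume : Measure ℝ)) φ).symm ▸ φ.memSobolev⟩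

theorem hasVariationalDerivative_energyH2 (u : Hs s) :
    HasVariationalDerivative (energyH2 σ) u.toL2 (modPowMul hs σ u u).toL2 := by
  refine hasVariationalDerivative_iff_inner.mpr fun φ => ?_
  set h : Hs s := Hs.ofSchwartz s φ
  have hline := Hs.hasDerivAt_toL2_line (by linarith) (differentiableAt_id (x := u)) h
  have hline_modPow :=
    Hs.hasDerivAt_toL2_line (by linarith) (differentiable_modPowMul_self hs σ u) h
  have hinner : HasDerivAt
      (fun ε : ℝ => inner ℝ (u + ε • h).toL2 (modPowMul hs σ (u + ε • h) (u + ε • h)).toL2)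
      ((2 * (σ : ℝ) + 2) * inner ℝ (modPowMul hs σ u u).toL2 h.toL2) 0 := by
    rw [← inner_fderiv_modPowMul_self]
    simpa only [id_eq, zero_smul, add_zero, fderiv_id, ContinuousLinearMap.id_apply] using
      hline.inner ℝ hline_modPow
  have henergy (ε : ℝ) : energyH2 σ (u.toL2 + ε • φ.toLp 2 (volume : Measure ℝ)) =
      1 / (2 * (σ : ℝ) + 2) *
        inner ℝ (u + ε • h).toL2 (modPowMul hs σ (u + ε • h) (u + ε • h)).toL2 := by
    rw [← energyH2_eq_inner hs σ, Hs.toL2_add_real_smul]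
    rfl
  simp only [henergy]
  refine (hinner.const_mul _).congr_deriv ?_
  rw [one_div, inv_mul_cancel_left₀ (by positivity)]
  rfl

end NonlinearStep

theorem exists_nonlinear_flow {s : ℝ} (hs : 1 / 2 < s) (σ : ℕ) (u₀ : Hs s) : ∃ U : ℝ → Hs s,
    U 0 = u₀ ∧ (∀ t, (U t).toL2 = nlStep σ t u₀.toL2) ∧
      ∀ t, ∃ g : Hs s,
        (∀ᵐ x, g.toL2 x = ((‖(U t).toL2 x‖ ^ (2 * σ) : ℝ) : ℂ) * (U t).toL2 x) ∧
        HasVariationalDerivative (energyH2 σ) (U t).toL2 g.toL2 ∧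
        HasDerivAt U (Complex.I • g) t := by
  have := Hs.completeSpace (show 0 ≤ s by linarith)
  refine ⟨fun t => nlStepHs hs σ t u₀, ?_, fun t => toL2_nlStepHs hs σ t u₀, fun t => ?_⟩
  · simp only [nlStepHs, zero_smul, NormedSpace.exp_zero, one_apply_eq_self]
  set u := nlStepHs hs σ t u₀ with hu
  refine ⟨modPowMul hs σ u u, isMultiplicationBy_modPowMul hs σ u u,
    hasVariationalDerivative_energyH2 hs σ u, ?_⟩
  have hmod : modPowMul hs σ u u = modPowMul hs σ u₀ u := by
    refine Hs.ext_ae ?_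
    filter_upwards [isMultiplicationBy_modPowMul hs σ u u, isMultiplicationBy_modPowMul hs σ u₀ u,
      isMultiplicationBy_exp_modPowMul hs σ t u₀ u₀] with x hux hu₀x hexp
    have hnorm : ‖u.toL2 x‖ = ‖u₀.toL2 x‖ := by
      rw [hu, nlStepHs, hexp, norm_mul, mul_comm Complex.I, Complex.norm_exp_ofReal_mul_I, one_mul]
    rw [hux, hu₀x, hnorm]
  rw [hmod]
  exact ((ContinuousLinearMap.apply ℂ (Hs s) u₀).restrictScalars ℝ).hasFDerivAt.comp_hasDerivAt t
    (hasDerivAt_exp_smul_const' (𝕂 := ℝ) (Complex.I • modPowMul hs σ u₀) t)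

section UnitarySubsteps

theorem norm_exp_I_mul_ofReal (t : ℝ) : ‖Complex.exp (Complex.I * (t : ℂ))‖ = 1 := by
  rw [mul_comm, Complex.norm_exp_ofReal_mul_I]

theorem phaseMul_phaseMul_of_add_eq_zero {θ ζ : ℝ → ℝ} (hθ : AEMeasurable θ) (hζ : AEMeasurable ζ)
    (h : ∀ x, ζ x + θ x = 0) (f : L2) : phaseMul ζ hζ (phaseMul θ hθ f) = f := by
  refine Lp.ext ?_
  filter_upwards [coeFn_phaseMul ζ hζ (phaseMul θ hθ f), coeFn_phaseMul θ hθ f] with x hζx hθx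
  rw [hζx, hθx, ← mul_assoc, ← Complex.exp_add, ← mul_add, ← Complex.ofReal_add, h,
    Complex.ofReal_zero, mul_zero, Complex.exp_zero, one_mul]

theorem norm_phaseMul {θ : ℝ → ℝ} (hθ : AEMeasurable θ) (f : L2) : ‖phaseMul θ hθ f‖ = ‖f‖ := by
  rw [Lp.norm_def, Lp.norm_def]
  refine congrArg _ (eLpNorm_congr_norm_ae ?_)
  filter_upwards [coeFn_phaseMul θ hθ f] with x hx
  rw [hx, norm_mul, norm_exp_I_mul_ofReal, one_mul]

/-- Multiplication by `exp(i θ)` as a unitary operator on `L²`. -/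
def phaseMulₗᵢ (θ : ℝ → ℝ) (hθ : AEMeasurable θ) : L2 ≃ₗᵢ[ℂ] L2 where
  toFun := phaseMul θ hθ
  invFun := phaseMul (fun x => -θ x) hθ.neg
  map_add' f g := by
    refine Lp.ext ?_
    filter_upwards [coeFn_phaseMul θ hθ (f + g), coeFn_phaseMul θ hθ f, coeFn_phaseMul θ hθ g,
      Lp.coeFn_add f g, Lp.coeFn_add (phaseMul θ hθ f) (phaseMul θ hθ g)] with x hfg hf hg h h'
    rw [hfg, h', h, Pi.add_apply, Pi.add_apply, hf, hg, mul_add]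
  map_smul' c f := by
    refine Lp.ext ?_
    filter_upwards [coeFn_phaseMul θ hθ (c • f), coeFn_phaseMul θ hθ f,
      Lp.coeFn_smul c f, Lp.coeFn_smul c (phaseMul θ hθ f)] with x hcf hf h h'
    rw [hcf, RingHom.id_apply, h', h, Pi.smul_apply, Pi.smul_apply, hf, smul_eq_mul, smul_eq_mul,
      mul_left_comm]
  left_inv := phaseMul_phaseMul_of_add_eq_zero hθ hθ.neg fun x => neg_add_cancel (θ x)
  right_inv := phaseMul_phaseMul_of_add_eq_zero hθ.neg hθ fun x => add_neg_cancel (θ x)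
  norm_map' := norm_phaseMul hθ

/-- The linear substep `exp(i r Δ)` as a unitary operator on `L²`. -/
def freeStepₗᵢ (r : ℝ) : L2 ≃ₗᵢ[ℂ] L2 :=
  ((Lp.fourierTransformₗᵢ ℝ ℂ).trans (phaseMulₗᵢ _ (aemeasurable_freePhase r))).trans
    (Lp.fourierTransformₗᵢ ℝ ℂ).symm

theorem norm_nlStep (σ : ℕ) (τ : ℝ) (f : L2) : ‖nlStep σ τ f‖ = ‖f‖ :=
  norm_phaseMul _ f

theorem norm_freeStep (r : ℝ) (f : L2) : ‖freeStep r f‖ = ‖f‖ :=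
  (freeStepₗᵢ r).norm_map f

theorem fourier_freeStep (r : ℝ) (f : L2) :
    (𝓕 (freeStep r f) : L2) =ᵐ[volume] fun ξ =>
      Complex.exp (Complex.I * ((-r * (2 * Real.pi * ξ) ^ 2 : ℝ) : ℂ)) * (𝓕 f : L2) ξ := by
  rw [freeStep, FourierTransform.fourier_fourierInv_eq]
  exact coeFn_phaseMul _ _ _

theorem charge_eq_norm_sq (f : L2) : charge f = ‖f‖ ^ 2 := by
  rw [← real_inner_self_eq_norm_sq, L2.inner_def]
  simp only [real_inner_self_eq_norm_sq, charge]

theorem symplecticForm_eq_im_inner (h k : L2) : symplecticForm h k = (inner ℂ h k : ℂ).im := by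
  rw [L2.inner_def, symplecticForm_eq_integral_im]
  refine .trans ?_ (integral_im (L2.integrable_inner (𝕜 := ℂ) h k))
  simp only [RCLike.inner_apply', RCLike.im_eq_complex_im]

theorem symplecticForm_freeStep (r : ℝ) (h k : L2) :
    symplecticForm (freeStep r h) (freeStep r k) = symplecticForm h k := by
  rw [symplecticForm_eq_im_inner, symplecticForm_eq_im_inner]
  exact congrArg Complex.im ((freeStepₗᵢ r).inner_map_map h k)

theorem besselPotential_freeStep {s : ℝ} {f g : L2}
    (h : besselPotential ℝ ℂ s (f : 𝓢'(ℝ, ℂ)) = (g : 𝓢'(ℝ, ℂ))) (r : ℝ) :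
    besselPotential ℝ ℂ s (freeStep r f : 𝓢'(ℝ, ℂ)) = (freeStep r g : 𝓢'(ℝ, ℂ)) := by
  refine besselPotential_eq_iff_fourier.mpr ?_
  filter_upwards [besselPotential_eq_iff_fourier.mp h, fourier_freeStep r f,
    fourier_freeStep r g] with ξ hfg hf hg
  rw [hf, hg, hfg, mul_smul_comm]

/-- The linear substep `exp(i r Δ)` as a linear isometry of `H^s`. -/
def freeStepHs (s r : ℝ) : Hs s →ₗᵢ[ℂ] Hs s where
  toFun u := ⟨freeStep r u.toL2, freeStep r u.bessel, besselPotential_freeStep u.bessel_spec r⟩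
  map_add' u v := Hs.toL2_injective ((freeStepₗᵢ r).map_add u.toL2 v.toL2)
  map_smul' c u := Hs.toL2_injective ((freeStepₗᵢ r).map_smul c u.toL2)
  norm_map' u := by
    rw [Hs.norm_eq_norm_bessel, Hs.norm_eq_norm_bessel, ← norm_freeStep r u.bessel]
    exact congrArg _ (Hs.besselFun_eq _ (besselPotential_freeStep u.bessel_spec r))

theorem toL2_freeStepHs {s : ℝ} (r : ℝ) (u : Hs s) :
    (freeStepHs s r u).toL2 = freeStep r u.toL2 :=
  rfl

end UnitarySubsteps

section Scheme

variable {s : ℝ} (hs : 1 / 2 < s) (σ : ℕ) (T : ℝ≥0) (N : ℕ) (w : ℝ≥0 → ℝ)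

theorem charge_lieScheme_succ (n : ℕ) (u : L2) :
    charge (lieScheme σ T N w (n + 1) u) = charge (lieScheme σ T N w n u) := by
  rw [charge_eq_norm_sq, charge_eq_norm_sq, lieScheme, norm_freeStep, norm_nlStep]

/-- The Lie splitting scheme as a map of `H^s` to itself. -/
def lieHs : ℕ → Hs s → Hs s
  | 0, u => u
  | n + 1, u => freeStepHs s (increment w T N n) (nlStepHs hs σ ((T : ℝ) / N) (lieHs n u))

theorem toL2_lieHs (n : ℕ) (u : Hs s) :
    (lieHs hs σ T N w n u).toL2 = lieScheme σ T N w n u.toL2 := by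
  induction n with
  | zero => rfl
  | succ n ih => rw [lieHs, lieScheme, toL2_freeStepHs, toL2_nlStepHs, ih]

theorem differentiable_lieHs (n : ℕ) : Differentiable ℝ (lieHs hs σ T N w n) := by
  induction n with
  | zero => exact differentiable_id
  | succ n ih =>
    exact ((freeStepHs s _).toContinuousLinearMap.differentiable.restrictScalars ℝ).comp
      ((differentiable_nlStepHs hs σ _).comp ih)

theorem hasFDerivAt_lieScheme (n : ℕ) (u : Hs s) :
    HasFDerivAt (fun v : Hs s => lieScheme σ T N w n v.toL2)
      (((Hs.toL2CLM (by linarith : 0 ≤ s)).restrictScalars ℝ).comp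
        (fderiv ℝ (lieHs hs σ T N w n) u)) u := by
  simp only [← toL2_lieHs hs]
  exact ((Hs.toL2CLM (by linarith : 0 ≤ s)).restrictScalars ℝ).hasFDerivAt.comp u
    (differentiable_lieHs hs σ T N w n u).hasFDerivAt

theorem schemeForm_eq_symplecticForm_fderiv (n : ℕ) (u h k : Hs s) :
    schemeForm s σ T N w n u h k = symplecticForm (fderiv ℝ (lieHs hs σ T N w n) u h).toL2
      (fderiv ℝ (lieHs hs σ T N w n) u k).toL2 := by
  rw [schemeForm, (hasFDerivAt_lieScheme hs σ T N w n u).fderiv]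
  rfl

theorem fderiv_lieHs_succ (n : ℕ) (u h : Hs s) :
    fderiv ℝ (lieHs hs σ T N w (n + 1)) u h = freeStepHs s (increment w T N n)
      (fderiv ℝ (nlStepHs hs σ ((T : ℝ) / N)) (lieHs hs σ T N w n u)
        (fderiv ℝ (lieHs hs σ T N w n) u h)) :=
  let freeStepHsℝ := (freeStepHs s (increment w T N n)).toContinuousLinearMap.restrictScalars ℝ
  congrArg (· h) (freeStepHsℝ.hasFDerivAt.comp u
    ((differentiable_nlStepHs hs σ _ _).hasFDerivAt.comp u
      (differentiable_lieHs hs σ T N w n u).hasFDerivAt)).fderiv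

end Scheme

theorem schemeForm_succ {s : ℝ} (hs : 1 / 2 < s) (σ : ℕ) (T : ℝ≥0) (N : ℕ) (w : ℝ≥0 → ℝ) (n : ℕ)
    (u h k : Hs s) :
    schemeForm s σ T N w (n + 1) u h k = schemeForm s σ T N w n u h k := by
  rw [schemeForm_eq_symplecticForm_fderiv hs, schemeForm_eq_symplecticForm_fderiv hs,
    fderiv_lieHs_succ, fderiv_lieHs_succ, toL2_freeStepHs, toL2_freeStepHs,
    symplecticForm_freeStep, symplecticForm_fderiv_nlStepHs]

section DominatedConvergence

open Filter Topology

variable {X E : Type*} {mX : MeasurableSpace X} {μ : Measure X} [NormedAddCommGroup E]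
  {p : ℝ≥0∞} [Fact (1 ≤ p)]

theorem tendsto_Lp_of_dominated {ι : Type*} {l : Filter ι} [l.IsCountablyGenerated] (hp : p ≠ ∞)
    {f : ι → Lp E p μ} {g : Lp E p μ} {F : ι → X → E} {G : X → E} {b : X → ℝ} (hb : MemLp b p μ)
    (hF : ∀ i, f i =ᵐ[μ] F i) (hG : g =ᵐ[μ] G)
    (hbound : ∀ᶠ i in l, ∀ᵐ x ∂μ, ‖F i x - G x‖ ≤ b x)
    (hlim : ∀ᵐ x ∂μ, Tendsto (fun i => F i x) l (𝓝 (G x))) : Tendsto f l (𝓝 g) := by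
  have hp₀ : p ≠ 0 := (zero_lt_one.trans_le Fact.out).ne'
  have hp_pos : 0 < p.toReal := ENNReal.toReal_pos hp₀ hp
  have hlintegral : Tendsto (fun i => ∫⁻ x, ‖F i x - G x‖ₑ ^ p.toReal ∂μ) l
      (𝓝 (∫⁻ _, 0 ∂μ)) := by
    refine tendsto_lintegral_filter_of_dominated_convergence' (fun x => ‖b x‖ₑ ^ p.toReal)
      (.of_forall fun i => ?_) ?_ ?_ ?_
    · exact ((((Lp.aestronglyMeasurable (f i)).congr (hF i)).sub
        ((Lp.aestronglyMeasurable g).congr hG)).enorm).pow_const _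
    · filter_upwards [hbound] with i hi
      filter_upwards [hi] with x hx
      gcongr
      exact enorm_le_iff_norm_le.mpr (hx.trans (le_abs_self _))
    · exact ((eLpNorm_lt_top_iff_lintegral_rpow_enorm_lt_top hp₀ hp).mp hb.2).ne
    · filter_upwards [hlim] with x hx
      have hsub := ((hx.sub_const (G x)).enorm).ennrpow_const p.toReal
      rwa [sub_self, enorm_zero, ENNReal.zero_rpow_of_pos hp_pos] at hsub
  rw [lintegral_zero] at hlintegral
  rw [Lp.tendsto_Lp_iff_tendsto_eLpNorm']
  have hpow := hlintegral.ennrpow_const (1 / p.toReal)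
  rw [ENNReal.zero_rpow_of_pos (by positivity)] at hpow
  refine hpow.congr fun i => ?_
  rw [eLpNorm_congr_ae ((hF i).sub hG), eLpNorm_eq_lintegral_rpow_enorm_toReal hp₀ hp]
  rfl

theorem hasDerivAt_Lp_of_dominated [NormedSpace ℝ E] (hp : p ≠ ∞) {c : ℝ → Lp E p μ}
    {c' : Lp E p μ} {F : ℝ → X → E} {F' : X → E} {b : X → ℝ} {t : ℝ} (hb : MemLp b p μ)
    (hF : ∀ r, c r =ᵐ[μ] F r) (hF' : c' =ᵐ[μ] F')
    (hlip : ∀ r, ∀ᵐ x ∂μ, ‖F r x - F t x‖ ≤ b x * ‖r - t‖)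
    (hderiv : ∀ᵐ x ∂μ, HasDerivAt (fun r => F r x) (F' x) t) : HasDerivAt c c' t := by
  rw [hasDerivAt_iff_tendsto_slope]
  refine tendsto_Lp_of_dominated (F := fun r x => slope (fun r => F r x) t r) hp
    (hb.add ((Lp.memLp c').ae_eq hF').norm) (fun r => ?_) hF' ?_ ?_
  · filter_upwards [Lp.coeFn_smul (r - t)⁻¹ (c r - c t), Lp.coeFn_sub (c r) (c t), hF r, hF t]
      with x hsmul hsub hr ht
    rw [slope_def_module, hsmul, Pi.smul_apply, hsub, Pi.sub_apply, hr, ht, slope_def_module]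
  · filter_upwards [self_mem_nhdsWithin] with r hr
    filter_upwards [hlip r] with x hx
    have hpos : 0 < ‖r - t‖ := norm_pos_iff.mpr (sub_ne_zero.mpr hr)
    refine (norm_sub_le _ _).trans (add_le_add_left ?_ _)
    rwa [slope_def_module, norm_smul, norm_inv, inv_mul_le_iff₀' hpos]
  · exact hderiv.mono fun x hx => hasDerivAt_iff_tendsto_slope.mp hx

end DominatedConvergence

section LinearFlow

open Filter Topology

theorem laplacian_eq_lineDeriv_lineDeriv (f : 𝓢'(ℝ, ℂ)) : Δ f = ∂_{(1 : ℝ)} (∂_{(1 : ℝ)} f) := by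
  rw [TemperedDistribution.laplacian_eq_sum (OrthonormalBasis.singleton Unit ℝ),
    Fintype.sum_unique, OrthonormalBasis.singleton_apply]

theorem weakDeriv_eq_of_lineDeriv_eq {f g : L2}
    (h : ∂_{(1 : ℝ)} (f : 𝓢'(ℝ, ℂ)) = (g : 𝓢'(ℝ, ℂ))) : weakDeriv f = g := by
  have hex : ∃ g : L2, ∂_{(1 : ℝ)} (f : 𝓢'(ℝ, ℂ)) = (g : 𝓢'(ℝ, ℂ)) := ⟨g, h⟩
  rw [weakDeriv, dif_pos hex]
  exact toTemperedDistribution_injective (hex.choose_spec.symm.trans h)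

theorem lineDeriv_add_real_smul {f g f' g' : L2}
    (hf : ∂_{(1 : ℝ)} (f : 𝓢'(ℝ, ℂ)) = (f' : 𝓢'(ℝ, ℂ)))
    (hg : ∂_{(1 : ℝ)} (g : 𝓢'(ℝ, ℂ)) = (g' : 𝓢'(ℝ, ℂ))) (ε : ℝ) :
    ∂_{(1 : ℝ)} ((f + ε • g : L2) : 𝓢'(ℝ, ℂ)) = ((f' + ε • g' : L2) : 𝓢'(ℝ, ℂ)) := by
  simp only [← Lp.toTemperedDistributionCLM_apply] at hf hg ⊢
  simp only [map_add, ContinuousLinearMap.map_smul_of_tower, LineDeriv.lineDerivOp_add,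
    LineDeriv.lineDerivOp_smul, hf, hg]

theorem lineDeriv_toLp (φ : 𝓢(ℝ, ℂ)) :
    ∂_{(1 : ℝ)} (φ.toLp 2 (volume : Measure ℝ) : 𝓢'(ℝ, ℂ)) =
      ((∂_{(1 : ℝ)} φ).toLp 2 (volume : Measure ℝ) : 𝓢'(ℝ, ℂ)) := by
  rw [Lp.toTemperedDistribution_toLp_eq, Lp.toTemperedDistribution_toLp_eq,
    TemperedDistribution.lineDerivOp_toTemperedDistributionCLM_eq]

theorem real_inner_eq_re_inner_L2 (f g : L2) : inner ℝ f g = (inner ℂ f g : ℂ).re := by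
  rw [L2.inner_def, L2.inner_def]
  exact integral_re (L2.integrable_inner (𝕜 := ℂ) f g)

theorem energyH1_eq_norm_sq {f f' : L2} (h : ∂_{(1 : ℝ)} (f : 𝓢'(ℝ, ℂ)) = (f' : 𝓢'(ℝ, ℂ))) :
    energyH1 f = -(1 / 2) * ‖f'‖ ^ 2 := by
  rw [← charge_eq_norm_sq, energyH1, weakDeriv_eq_of_lineDeriv_eq h]
  rfl

theorem hasVariationalDerivative_energyH1 {f f' f'' : L2}
    (hf : ∂_{(1 : ℝ)} (f : 𝓢'(ℝ, ℂ)) = (f' : 𝓢'(ℝ, ℂ)))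
    (hf' : ∂_{(1 : ℝ)} (f' : 𝓢'(ℝ, ℂ)) = (f'' : 𝓢'(ℝ, ℂ))) :
    HasVariationalDerivative energyH1 f f'' := by
  refine hasVariationalDerivative_iff_inner.mpr fun φ => ?_
  simp only [energyH1_eq_norm_sq (lineDeriv_add_real_smul hf (lineDeriv_toLp φ) _)]
  have hline := ((hasDerivAt_id (0 : ℝ)).smul_const
    ((∂_{(1 : ℝ)} φ).toLp 2 (volume : Measure ℝ))).const_add f'
  refine (hline.norm_sq.const_mul _).congr_deriv ?_
  rw [id_eq, zero_smul, add_zero, one_smul, real_inner_eq_re_inner_L2,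
    inner_lineDeriv_eq_neg hf' (lineDeriv_toLp φ), real_inner_eq_re_inner_L2, Complex.neg_re]
  ring

theorem laplacian_eq_iff_fourier {f g : L2} :
    Δ (f : 𝓢'(ℝ, ℂ)) = (g : 𝓢'(ℝ, ℂ)) ↔
      (𝓕 g : L2) =ᵐ[volume] fun ξ => -((2 * Real.pi * ξ) ^ 2 : ℝ) * (𝓕 f : L2) ξ := by
  rw [laplacian_eq_fourierMultiplierCLM_negLaplaceSymbol]
  simp only [Real.norm_eq_abs, mul_pow, sq_abs]
  exact fourierMultiplierCLM_eq_iff (by fun_prop)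

theorem lineDeriv_freeStep {f g : L2} (h : ∂_{(1 : ℝ)} (f : 𝓢'(ℝ, ℂ)) = (g : 𝓢'(ℝ, ℂ))) (r : ℝ) :
    ∂_{(1 : ℝ)} (freeStep r f : 𝓢'(ℝ, ℂ)) = (freeStep r g : 𝓢'(ℝ, ℂ)) := by
  refine lineDeriv_eq_iff_fourier.mpr ?_
  filter_upwards [lineDeriv_eq_iff_fourier.mp h, fourier_freeStep r f, fourier_freeStep r g]
    with ξ hfg hf hg
  rw [hf, hg, hfg, mul_smul_comm]

theorem freeStep_zero (f : L2) : freeStep 0 f = f := by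
  refine (Lp.fourierTransformₗᵢ ℝ ℂ).injective (Lp.ext ?_)
  filter_upwards [fourier_freeStep 0 f] with ξ hξ
  refine hξ.trans ?_
  simp only [neg_zero, zero_mul, Complex.ofReal_zero, mul_zero, Complex.exp_zero, one_mul]
  rfl

/-- The symbol of the linear substep. -/
def freeSymbol (r ξ : ℝ) : ℂ := Complex.exp (Complex.I * ((-r * (2 * Real.pi * ξ) ^ 2 : ℝ) : ℂ))

theorem hasDerivAt_freeSymbol (r ξ : ℝ) :
    HasDerivAt (fun r => freeSymbol r ξ)
      (Complex.I * (-(((2 * Real.pi * ξ) ^ 2 : ℝ) : ℂ) * freeSymbol r ξ)) r := by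
  have hphase := (((hasDerivAt_id r).neg.mul_const
    ((2 * Real.pi * ξ) ^ 2)).ofReal_comp.const_mul Complex.I).cexp
  refine hphase.congr_deriv ?_
  simp only [freeSymbol, Pi.neg_apply, id_eq, neg_mul, one_mul, Complex.ofReal_neg]
  ring

theorem norm_freeSymbol_sub_le (r r' ξ : ℝ) :
    ‖freeSymbol r ξ - freeSymbol r' ξ‖ ≤ (2 * Real.pi * ξ) ^ 2 * ‖r - r'‖ := by
  refine Convex.norm_image_sub_le_of_norm_hasDerivWithin_le (s := Set.univ)
    (fun ρ _ => (hasDerivAt_freeSymbol ρ ξ).hasDerivWithinAt) (fun ρ _ => ?_) convex_univ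
    (Set.mem_univ _) (Set.mem_univ _)
  rw [norm_mul, norm_mul, Complex.norm_I, one_mul, norm_neg, freeSymbol, norm_exp_I_mul_ofReal,
    mul_one, Complex.norm_real, Real.norm_of_nonneg (by positivity)]

theorem continuous_freeStep (f : L2) : Continuous fun r => freeStep r f := by
  refine (Lp.fourierTransformₗᵢ ℝ ℂ).symm.continuous.comp (continuous_iff_continuousAt.mpr
    fun r₀ => tendsto_Lp_of_dominated ENNReal.ofNat_ne_top
      ((Lp.memLp (𝓕 f : L2)).norm.const_mul 2) (fun r => coeFn_phaseMul _ _ _)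
      (coeFn_phaseMul _ _ _) ?_ ?_)
  · refine .of_forall fun r => .of_forall fun ξ => (norm_sub_le _ _).trans_eq ?_
    rw [norm_mul, norm_mul, norm_exp_I_mul_ofReal, norm_exp_I_mul_ofReal]
    ring
  · exact .of_forall fun ξ => (hasDerivAt_freeSymbol r₀ ξ).continuousAt.tendsto.mul_const _

theorem hasDerivAt_freeStep {f g : L2} (h : Δ (f : 𝓢'(ℝ, ℂ)) = (g : 𝓢'(ℝ, ℂ))) (r₀ : ℝ) :
    HasDerivAt (fun r => freeStep r f) (Complex.I • freeStep r₀ g) r₀ := by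
  rw [laplacian_eq_iff_fourier] at h
  have hmemLp : MemLp (fun ξ => (2 * Real.pi * ξ) ^ 2 * ‖(𝓕 f : L2) ξ‖) 2 := by
    refine (Lp.memLp (𝓕 g : L2)).norm.ae_eq ?_
    filter_upwards [h] with ξ hξ
    rw [hξ, norm_mul, norm_neg, Complex.norm_real, Real.norm_of_nonneg (by positivity)]
  have hfourier : HasDerivAt (fun r => phaseMul _ (aemeasurable_freePhase r) (𝓕 f))
      (Complex.I • phaseMul _ (aemeasurable_freePhase r₀) (𝓕 g)) r₀ := by
    refine hasDerivAt_Lp_of_dominated (F := fun r ξ => freeSymbol r ξ * (𝓕 f : L2) ξ)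
      ENNReal.ofNat_ne_top hmemLp (fun r => coeFn_phaseMul _ _ _) ?_
      (fun r => .of_forall fun ξ => ?_)
      (.of_forall fun ξ => (hasDerivAt_freeSymbol r₀ ξ).mul_const _)
    · filter_upwards [Lp.coeFn_smul Complex.I (phaseMul _ (aemeasurable_freePhase r₀) (𝓕 g)),
        coeFn_phaseMul _ (aemeasurable_freePhase r₀) (𝓕 g), h] with ξ hsmul hphase hg
      rw [hsmul, Pi.smul_apply, hphase, hg, smul_eq_mul, freeSymbol]
      ring
    · rw [← sub_mul, norm_mul, mul_right_comm]
      gcongr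
      exact norm_freeSymbol_sub_le r r₀ ξ
  have hinv := ((Lp.fourierTransformₗᵢ ℝ ℂ).symm : L2 →L[ℂ] L2).restrictScalars
    ℝ |>.hasFDerivAt.comp_hasDerivAt r₀ hfourier
  exact hinv.congr_deriv (map_smul (Lp.fourierTransformₗᵢ ℝ ℂ).symm _ _)

theorem exists_linear_flow {v : L2} (hv : MemSobolev 2 2 (v : 𝓢'(ℝ, ℂ))) (r : ℝ) :
    ∃ g : L2, (g : 𝓢'(ℝ, ℂ)) = Δ (freeStep r v : 𝓢'(ℝ, ℂ)) ∧
      HasVariationalDerivative energyH1 (freeStep r v) g ∧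
      HasDerivAt (fun r : ℝ => freeStep r v) (Complex.I • g) r := by
  obtain ⟨v', hv'⟩ := memSobolev_zero_iff.mp ((hv.lineDerivOp (m := (1 : ℝ))).mono (by norm_num))
  obtain ⟨v'', hv''⟩ := memSobolev_zero_iff.mp (hv.laplacian.mono (by norm_num))
  have hv'_deriv : ∂_{(1 : ℝ)} (v' : 𝓢'(ℝ, ℂ)) = (v'' : 𝓢'(ℝ, ℂ)) := by
    rw [← hv', ← laplacian_eq_lineDeriv_lineDeriv, hv'']
  refine ⟨freeStep r v'', ?_, hasVariationalDerivative_energyH1 (lineDeriv_freeStep hv' r)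
    (lineDeriv_freeStep hv'_deriv r), hasDerivAt_freeStep hv'' r⟩
  rw [laplacian_eq_lineDeriv_lineDeriv, lineDeriv_freeStep hv', lineDeriv_freeStep hv'_deriv]

end LinearFlow

section TrapezoidalRule

variable {E : Type*} [NormedAddCommGroup E] [NormedSpace ℝ E]

theorem norm_le_pow_succ_of_norm_deriv_le_pow {G G' : ℝ → E} {a C : ℝ} {n : ℕ} (hGa : G a = 0)
    (hG : ∀ x, HasDerivAt G (G' x) x) (hbound : ∀ x, ‖G' x‖ ≤ C * |x - a| ^ n) (b : ℝ) :
    ‖G b‖ ≤ C * |b - a| ^ (n + 1) := by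
  rcases eq_or_ne b a with rfl | hne
  · rw [hGa, norm_zero, sub_self, abs_zero, zero_pow n.succ_ne_zero, mul_zero]
  have hC : 0 ≤ C := nonneg_of_mul_nonneg_left ((norm_nonneg _).trans (hbound b))
    (pow_pos (abs_pos.mpr (sub_ne_zero.mpr hne)) n)
  have hmean := (convex_closedBall a |b - a|).norm_image_sub_le_of_norm_hasDerivWithin_le
    (fun x _ => (hG x).hasDerivWithinAt)
    (fun x hx => (hbound x).trans (mul_le_mul_of_nonneg_left
      (pow_le_pow_left₀ (abs_nonneg _) (mem_closedBall_iff_norm.mp hx) n) hC))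
    (Metric.mem_closedBall_self (abs_nonneg _)) (mem_closedBall_iff_norm.mpr le_rfl)
  rwa [hGa, sub_zero, Real.norm_eq_abs, mul_assoc, ← pow_succ] at hmean

theorem norm_trapezoid_sub_le {F F' F'' F''' : ℝ → E} {K : ℝ}
    (hF : ∀ x, HasDerivAt F (F' x) x) (hF' : ∀ x, HasDerivAt F' (F'' x) x)
    (hF'' : ∀ x, HasDerivAt F'' (F''' x) x) (hK : ∀ x, ‖F''' x‖ ≤ K) (a b : ℝ) :
    ‖((b - a) / 2) • (F' a + F' b) - (F b - F a)‖ ≤ K / 2 * |b - a| ^ 3 := by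
  have hhalf (x : ℝ) : HasDerivAt (fun x => (x - a) / 2) (1 / 2) x :=
    ((hasDerivAt_id x).sub_const a).div_const 2
  refine norm_le_pow_succ_of_norm_deriv_le_pow
    (G := fun x => ((x - a) / 2) • (F' a + F' x) - (F x - F a))
    (G' := fun x => ((x - a) / 2) • F'' x - (1 / 2 : ℝ) • (F' x - F' a)) (by simp) (fun x => ?_)
    (norm_le_pow_succ_of_norm_deriv_le_pow (G' := fun x => ((x - a) / 2) • F''' x) (by simp)
      (fun x => ?_) fun x => ?_) b
  · refine (((hhalf x).smul ((hF' x).const_add _)).sub ((hF x).sub_const _)).congr_deriv ?_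
    module
  · refine (((hhalf x).smul (hF'' x)).sub (((hF' x).sub_const _).const_smul _)).congr_deriv ?_
    module
  · rw [norm_smul, Real.norm_eq_abs, abs_div, abs_two, pow_one, div_mul_eq_mul_div,
      div_mul_eq_mul_div, mul_comm K]
    gcongr
    exact hK x

end TrapezoidalRule

section TestFunctions

variable {V F : Type*} [NormedAddCommGroup V] [InnerProductSpace ℝ V] [FiniteDimensional ℝ V]
  [MeasurableSpace V] [BorelSpace V] [NormedAddCommGroup F] [NormedSpace ℂ F]
  [CompleteSpace F]

theorem norm_toTemperedDistribution_apply_le (f : Lp (α := V) F 2)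
    (φ : 𝓢(V, ℂ)) : ‖(f : 𝓢'(V, F)) φ‖ ≤ ‖φ.toLp 2 (volume : Measure V)‖ * ‖f‖ := by
  have hpairing : (f : 𝓢'(V, F)) φ =
      L1.integral (φ.toLp 2 volume • f : Lp F 1 (volume : Measure V)) := by
    rw [Lp.toTemperedDistribution_apply, L1.integral_eq_integral]
    refine integral_congr_ae ?_
    filter_upwards [Lp.coeFn_lpSMul (r := 1) (φ.toLp 2 (volume : Measure V)) f,
      φ.coeFn_toLp 2 volume] with x hx hφ
    rw [hx, Pi.smul_apply', hφ]
  rw [hpairing]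
  exact (L1.norm_integral_le _).trans (Lp.norm_smul_le _ _)

theorem fourierInv_laplacian_apply (φ : 𝓢(V, F)) (ξ : V) :
    𝓕⁻ (Δ φ) ξ = (-(2 * Real.pi * ‖ξ‖) ^ 2 : ℝ) • 𝓕⁻ φ ξ := by
  have hfourier (η : V) : 𝓕 (Δ φ) η = (-(2 * Real.pi * ‖η‖) ^ 2 : ℝ) • 𝓕 φ η := by
    rw [SchwartzMap.laplacian_eq_fourierMultiplierCLM, FourierTransform.fourier_smul,
      SchwartzMap.fourierMultiplierCLM_apply, FourierTransform.fourier_fourierInv_eq,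
      smul_apply, SchwartzMap.smulLeftCLM_apply_apply (by fun_prop), smul_smul, neg_mul,
      ← mul_pow]
  simpa only [SchwartzMap.fourierInv_coe, SchwartzMap.fourier_coe, Real.fourierInv_eq_fourier_neg,
    norm_neg] using hfourier (-ξ)

theorem freeStep_apply_eq_integral (r : ℝ) (f : L2) (φ : 𝓢(ℝ, ℂ)) :
    (freeStep r f : 𝓢'(ℝ, ℂ)) φ = ∫ ξ, (𝓕⁻ φ) ξ * (freeSymbol r ξ * (𝓕 f : L2) ξ) := by
  rw [toTemperedDistribution_apply_eq_integral_fourier]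
  refine integral_congr_ae ?_
  filter_upwards [fourier_freeStep r f] with ξ hξ
  rw [hξ, smul_eq_mul, freeSymbol]

theorem integrable_fourierInv_mul_freeSymbol_mul (f : L2) (φ : 𝓢(ℝ, ℂ)) (r : ℝ) :
    Integrable fun ξ => (𝓕⁻ φ) ξ * (freeSymbol r ξ * (𝓕 f : L2) ξ) := by
  refine MemLp.integrable_mul ((𝓕⁻ φ).memLp 2) ((Lp.memLp (𝓕 (freeStep r f) : L2)).ae_eq ?_)
  filter_upwards [fourier_freeStep r f] with ξ hξ
  rw [hξ, freeSymbol]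

theorem hasDerivAt_freeStep_apply (f : L2) (φ : 𝓢(ℝ, ℂ)) (r₀ : ℝ) :
    HasDerivAt (fun r => (freeStep r f : 𝓢'(ℝ, ℂ)) φ)
      (Complex.I * (freeStep r₀ f : 𝓢'(ℝ, ℂ)) (Δ φ)) r₀ := by
  simp only [freeStep_apply_eq_integral]
  have hderiv (r ξ : ℝ) :
      HasDerivAt (fun r => (𝓕⁻ φ) ξ * (freeSymbol r ξ * (𝓕 f : L2) ξ))
        (Complex.I * ((𝓕⁻ (Δ φ)) ξ * (freeSymbol r ξ * (𝓕 f : L2) ξ))) r := by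
    refine (((hasDerivAt_freeSymbol r ξ).mul_const _).const_mul _).congr_deriv ?_
    rw [fourierInv_laplacian_apply, Complex.real_smul, Real.norm_eq_abs, mul_pow _ |ξ|, sq_abs,
      ← mul_pow, Complex.ofReal_neg]
    ring
  have hint := integrable_fourierInv_mul_freeSymbol_mul f
  refine (hasDerivAt_integral_of_dominated_loc_of_deriv_le Filter.univ_mem
    (.of_forall fun r => (hint φ r).aestronglyMeasurable) (hint φ r₀)
    ((hint (Δ φ) r₀).aestronglyMeasurable.const_mul Complex.I)
    (.of_forall fun ξ r _ => ?_) (hint (Δ φ) 0).norm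
    (.of_forall fun ξ r _ => hderiv r ξ)).2.congr_deriv (integral_const_mul _ _)
  simp only [norm_mul, Complex.norm_I, freeSymbol, norm_exp_I_mul_ofReal, one_mul, le_refl]

theorem norm_freeStep_trapezoid_sub_le (f : L2) (φ : 𝓢(ℝ, ℂ)) (r r' : ℝ) :
    ‖(Complex.I * (Δ (freeStep r f : 𝓢'(ℝ, ℂ))) φ + Complex.I * (Δ (freeStep r' f : 𝓢'(ℝ, ℂ))) φ)
        / 2 * ((r' - r : ℝ) : ℂ) -
      ((freeStep r' f : 𝓢'(ℝ, ℂ)) φ - (freeStep r f : 𝓢'(ℝ, ℂ)) φ)‖ ≤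
      ‖(Δ (Δ (Δ φ))).toLp 2 (volume : Measure ℝ)‖ * ‖f‖ / 2 * |r' - r| ^ 3 := by
  have hderiv := hasDerivAt_freeStep_apply f
  have herror := norm_trapezoid_sub_le (hderiv φ) (fun x => (hderiv (Δ φ) x).const_mul _)
    (fun x => ((hderiv (Δ (Δ φ)) x).const_mul _).const_mul _)
    (K := ‖(Δ (Δ (Δ φ))).toLp 2 (volume : Measure ℝ)‖ * ‖f‖) (fun x => ?_) r r'
  · rw [Complex.real_smul] at herror
    rw [laplacian_apply_apply, laplacian_apply_apply, div_mul_eq_mul_div, mul_comm,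
      mul_div_right_comm]
    exact_mod_cast herror
  · simp only [norm_mul, Complex.norm_I, one_mul]
    exact (norm_toTemperedDistribution_apply_le _ _).trans_eq (by rw [norm_freeStep])

end TestFunctions

section BrownianIncrements

theorem lintegral_enorm_pow_gaussianReal (p : ℕ) (v : ℝ≥0) :
    ∫⁻ x, ‖x‖ₑ ^ p ∂gaussianReal 0 v =
      (NNReal.sqrt v : ℝ≥0∞) ^ p * ∫⁻ x, ‖x‖ₑ ^ p ∂gaussianReal 0 1 := by
  have hscale : (gaussianReal 0 1).map ((NNReal.sqrt v : ℝ) * ·) = gaussianReal 0 v := by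
    rw [gaussianReal_map_const_mul, mul_zero, mul_one]
    congr 1
    exact NNReal.sq_sqrt v
  rw [← hscale, lintegral_map (by fun_prop) (by fun_prop), ← lintegral_const_mul _ (by fun_prop)]
  simp only [enorm_mul, mul_pow, Real.enorm_of_nonneg (NNReal.coe_nonneg _),
    ENNReal.ofReal_coe_nnreal]

theorem lintegral_enorm_pow_gaussianReal_ne_top (μ : ℝ) (v : ℝ≥0) (p : ℕ) :
    ∫⁻ x, ‖x‖ₑ ^ p ∂gaussianReal μ v ≠ ∞ := by
  have hfinite := (memLp_id_gaussianReal (μ := μ) (v := v) p).integrable_norm_pow'.2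
  simpa only [HasFiniteIntegral, enorm_pow, enorm_norm, id_eq] using hfinite.ne

variable {Ω : Type*} [MeasurableSpace Ω] {P : Measure Ω} {W : ℝ≥0 → Ω → ℝ}

theorem lintegral_enorm_pow_increment (hW : IsPreBrownianReal W P) (p : ℕ) {a b : ℝ≥0}
    (hab : a ≤ b) :
    ∫⁻ ω, ‖W b ω - W a ω‖ₑ ^ p ∂P =
      (NNReal.sqrt (b - a) : ℝ≥0∞) ^ p * ∫⁻ x, ‖x‖ₑ ^ p ∂gaussianReal 0 1 := by
  have hvar : nndist b.1 a.1 = b - a := by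
    ext
    rw [coe_nndist, Real.dist_eq, NNReal.coe_sub hab]
    exact abs_of_nonneg (sub_nonneg.mpr hab)
  have hlaw := hW.hasLaw_sub b a
  rw [hvar] at hlaw
  rw [← lintegral_enorm_pow_gaussianReal, ← hlaw.lintegral_comp (by fun_prop)]
  rfl

theorem lintegral_sum_enorm_increment_cube_le (hW : IsPreBrownianReal W P) {m : ℕ} {τ : ℕ → ℝ≥0}
    (hτ : Monotone τ) {δ : ℝ≥0} (hmesh : ∀ i < m, τ (i + 1) - τ i ≤ δ ^ 2) :
    ∫⁻ ω, ∑ i ∈ Finset.range m, ‖W (τ (i + 1)) ω - W (τ i) ω‖ₑ ^ 3 ∂P ≤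
      (δ * (τ m - τ 0) : ℝ≥0) * ∫⁻ x, ‖x‖ₑ ^ 3 ∂gaussianReal 0 1 := by
  have hmeas (i : ℕ) : AEMeasurable (fun ω => ‖W (τ (i + 1)) ω - W (τ i) ω‖ₑ ^ 3) P :=
    ((hW.aemeasurable _).sub (hW.aemeasurable _)).enorm.pow_const 3
  have hcube (i : ℕ) (hi : i < m) :
      NNReal.sqrt (τ (i + 1) - τ i) ^ 3 ≤ δ * (τ (i + 1) - τ i) := by
    rw [pow_succ', NNReal.sq_sqrt]
    gcongr
    exact NNReal.sqrt_le_iff_le_sq.mpr (hmesh i hi)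
  rw [lintegral_finsetSum' _ fun i _ => hmeas i, ← Finset.sum_range_tsub hτ, Finset.mul_sum,
    ENNReal.ofNNReal_finsetSum, Finset.sum_mul]
  refine Finset.sum_le_sum fun i hi => ?_
  rw [lintegral_enorm_pow_increment hW 3 (hτ i.le_succ)]
  gcongr
  exact_mod_cast hcube i (Finset.mem_range.mp hi)

end BrownianIncrements

section StratonovichIntegral

variable {Ω : Type*} [MeasurableSpace Ω] {P : Measure Ω} {W : ℝ≥0 → Ω → ℝ}

theorem measure_le_norm_trapezoidalSum_sub_le (hW : IsPreBrownianReal W P) {X Y : ℝ≥0 → Ω → ℂ}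
    {C : ℝ≥0} (h : ∀ r r' ω, ‖(X r ω + X r' ω) / 2 * ((W r' ω - W r ω : ℝ) : ℂ) -
      (Y r' ω - Y r ω)‖ ≤ C * |W r' ω - W r ω| ^ 3) {m : ℕ} {τ : ℕ → ℝ≥0} (hτ : Monotone τ)
    {δ : ℝ≥0} (hmesh : ∀ i < m, τ (i + 1) - τ i ≤ δ ^ 2) {ε : ℝ} (hε : 0 < ε) :
    P {ω | ε ≤ ‖(∑ i ∈ Finset.range m, (X (τ i) ω + X (τ (i + 1)) ω) / 2 *
        ((W (τ (i + 1)) ω - W (τ i) ω : ℝ) : ℂ)) - (Y (τ m) ω - Y (τ 0) ω)‖} ≤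
      C * ((δ * (τ m - τ 0) : ℝ≥0) * ∫⁻ x, ‖x‖ₑ ^ 3 ∂gaussianReal 0 1) / ENNReal.ofReal ε := by
  have hmeas : AEMeasurable (fun ω => C * ∑ i ∈ Finset.range m,
      ‖W (τ (i + 1)) ω - W (τ i) ω‖ₑ ^ 3) P :=
    (Finset.aemeasurable_fun_sum _ fun i _ =>
      ((hW.aemeasurable _).sub (hW.aemeasurable _)).enorm.pow_const 3).const_mul _
  have hsum (ω : Ω) : ‖(∑ i ∈ Finset.range m, (X (τ i) ω + X (τ (i + 1)) ω) / 2 *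
        ((W (τ (i + 1)) ω - W (τ i) ω : ℝ) : ℂ)) - (Y (τ m) ω - Y (τ 0) ω)‖ₑ ≤
      C * ∑ i ∈ Finset.range m, ‖W (τ (i + 1)) ω - W (τ i) ω‖ₑ ^ 3 := by
    rw [← Finset.sum_range_sub (fun i => Y (τ i) ω), ← Finset.sum_sub_distrib, Finset.mul_sum]
    refine (enorm_sum_le _ _).trans (Finset.sum_le_sum fun i _ => ?_)
    have := h (τ i) (τ (i + 1)) ω
    rw [← Real.norm_eq_abs] at this
    simp only [enorm_eq_nnnorm]
    exact_mod_cast this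
  calc _ ≤ P {ω | ENNReal.ofReal ε ≤
          C * ∑ i ∈ Finset.range m, ‖W (τ (i + 1)) ω - W (τ i) ω‖ₑ ^ 3} := by
        refine measure_mono fun ω hω => le_trans ?_ (hsum ω)
        rw [← ofReal_norm]
        exact ENNReal.ofReal_le_ofReal hω
    _ ≤ (∫⁻ ω, C * ∑ i ∈ Finset.range m, ‖W (τ (i + 1)) ω - W (τ i) ω‖ₑ ^ 3 ∂P) /
          ENNReal.ofReal ε :=
        meas_ge_le_lintegral_div hmeas (ENNReal.ofReal_pos.mpr hε).ne' ENNReal.ofReal_ne_top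
    _ ≤ _ := by
        rw [lintegral_const_mul' _ _ ENNReal.coe_ne_top]
        gcongr
        exact lintegral_sum_enorm_increment_cube_le hW hτ hmesh

theorem hasStratonovichIntegral_of_norm_trapezoid_sub_le (hW : IsPreBrownianReal W P)
    {X Y : ℝ≥0 → Ω → ℂ} {C : ℝ≥0} (h : ∀ r r' ω, ‖(X r ω + X r' ω) / 2 *
      ((W r' ω - W r ω : ℝ) : ℂ) - (Y r' ω - Y r ω)‖ ≤ C * |W r' ω - W r ω| ^ 3) (a b : ℝ≥0) :
    HasStratonovichIntegral P W X a b fun ω => Y b ω - Y a ω := by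
  intro ε hε η hη
  lift ε to ℝ≥0 using hε.le
  lift η to ℝ≥0 using hη.le
  obtain ⟨M, hM⟩ : ∃ M : ℝ≥0, ∫⁻ x, ‖x‖ₑ ^ 3 ∂gaussianReal 0 1 = M :=
    ⟨_, (ENNReal.coe_toNNReal (lintegral_enorm_pow_gaussianReal_ne_top 0 1 3)).symm⟩
  set K : ℝ≥0 := C * (b - a) * M / ε
  refine ⟨(η / (K + 1)) ^ 2, by positivity, fun m τ hτ h0 hm hmesh => ?_⟩
  have hbound := measure_le_norm_trapezoidalSum_sub_le hW h hτ (m := m) (δ := η / (K + 1))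
    (fun i hi => ?_) hε
  · rw [h0, hm, hM, ENNReal.ofReal_coe_nnreal, ← ENNReal.coe_mul, ← ENNReal.coe_mul,
      ← ENNReal.coe_div (NNReal.coe_pos.mp hε).ne'] at hbound
    rw [ENNReal.ofReal_coe_nnreal]
    refine hbound.trans (ENNReal.coe_le_coe.mpr ?_)
    calc C * (η / (K + 1) * (b - a) * M) / ε = η * (K / (K + 1)) := by ring
      _ ≤ η := mul_le_of_le_one_right' (div_le_one_of_le₀ le_self_add zero_le)
  · rw [← NNReal.coe_le_coe, NNReal.coe_sub (hτ i.le_succ)]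
    exact_mod_cast hmesh i hi

theorem norm_lieScheme (σ : ℕ) (T : ℝ≥0) (N : ℕ) (w : ℝ≥0 → ℝ) (n : ℕ) (u : L2) :
    ‖lieScheme σ T N w n u‖ = ‖u‖ := by
  induction n with
  | zero => rfl
  | succ n ih => rw [lieScheme, norm_freeStep, norm_nlStep, ih]

theorem norm_lieIntermediate (σ : ℕ) (T : ℝ≥0) (N : ℕ) (w : ℝ≥0 → ℝ) (n : ℕ) (u : L2) :
    ‖lieIntermediate σ T N w n u‖ = ‖u‖ := by
  rw [lieIntermediate, norm_nlStep, norm_lieScheme]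

theorem solvesLinearEquation_freeStep (hW : IsBrownianReal W P) (a b : ℝ≥0) {f : Ω → L2} {C : ℝ}
    (hf : ∀ ω, ‖f ω‖ ≤ C) :
    SolvesLinearEquation P W a b fun t ω => freeStep (W t ω - W a ω) (f ω) := by
  refine ⟨?_, fun t _ φ => ?_⟩
  · filter_upwards [hW.cont] with ω hω
    exact ((continuous_freeStep (f ω)).comp (hω.sub continuous_const)).continuousOn
  · refine hasStratonovichIntegral_of_norm_trapezoid_sub_le hW.toIsPreBrownianReal
      (Y := fun r ω => (freeStep (W r ω - W a ω) (f ω) : 𝓢'(ℝ, ℂ)) φ)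
      (C := (‖(Δ (Δ (Δ φ))).toLp 2 (volume : Measure ℝ)‖ * C / 2).toNNReal)
      (fun r r' ω => ?_) a t
    have herror := norm_freeStep_trapezoid_sub_le (f ω) φ (W r ω - W a ω) (W r' ω - W a ω)
    rw [sub_sub_sub_cancel_right] at herror
    refine herror.trans (mul_le_mul_of_nonneg_right (le_trans ?_ (Real.le_coe_toNNReal _))
      (by positivity))
    gcongr
    exact hf ω

end StratonovichIntegral

end WhiteNoiseNLS

end

theorem mainTheorem8 {Ω : Type*} [MeasurableSpace Ω] (P : Measure Ω) [IsProbabilityMeasure P]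
    (W : ℝ≥0 → Ω → ℝ) (hW : IsBrownianReal W P)
    (s : ℝ) (hs : 1 / 2 < s) (σ : ℕ) (T : ℝ≥0) (hT : 0 < T) (N : ℕ) (hN : 0 < N) :
    -- the scheme acts on `H^s`, differentiably, and preserves the symplectic form and the charge
    (∀ᵐ ω ∂P,
      (∀ n ≤ N, ∃ Φ : Hs s → Hs s,
        (∀ u, (Φ u).toL2 = lieScheme σ T N (W · ω) n u.toL2) ∧
        Differentiable ℝ Φ) ∧
      (∀ n ≤ N, Differentiable ℝ
        (fun u : Hs s => lieScheme σ T N (W · ω) n u.toL2)) ∧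
      (∀ n < N, ∀ u h k : Hs s,
        schemeForm s σ T N (W · ω) (n + 1) u h k =
          schemeForm s σ T N (W · ω) n u h k) ∧
      (∀ n < N, ∀ u : L2,
        charge (lieScheme σ T N (W · ω) (n + 1) u) =
          charge (lieScheme σ T N (W · ω) n u))) ∧
    -- the nonlinear substep is the exact flow of the Hamiltonian system of `H₂` in `H^s`
    (∀ u₀ : Hs s, ∃ U : ℝ → Hs s,
      U 0 = u₀ ∧ (∀ t, (U t).toL2 = nlStep σ t u₀.toL2) ∧
      ∀ t, ∃ g : Hs s,
        (∀ᵐ x, g.toL2 x = ((‖(U t).toL2 x‖ ^ (2 * σ) : ℝ) : ℂ) * (U t).toL2 x) ∧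
        HasVariationalDerivative (energyH2 σ) (U t).toL2 g.toL2 ∧
        HasDerivAt U (Complex.I • g) t) ∧
    -- the linear substep solves `du = i Δu ∘ dW` on each `[t_n, t_{n+1}]`
    (∀ n < N, ∀ u₀ : L2,
      SolvesLinearEquation P W (gridTime T N n)
        (gridTime T N (n + 1))
        (fun t ω => freeStep (W t ω - W (gridTime T N n) ω)
          (lieIntermediate σ T N (W · ω) n u₀))) ∧
    -- and `r ↦ exp(i r Δ)` is the exact flow of the Hamiltonian system of `H₁`
    (∀ v : L2, MemSobolev 2 2 (v : 𝓢'(ℝ, ℂ)) →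
      freeStep 0 v = v ∧
      ∀ r : ℝ, ∃ g : L2,
        (g : 𝓢'(ℝ, ℂ)) = Δ (freeStep r v : 𝓢'(ℝ, ℂ)) ∧
        HasVariationalDerivative energyH1
          (freeStep r v) g ∧
        HasDerivAt (fun r : ℝ => freeStep r v) (Complex.I • g) r) ∧
    -- the factors of both substeps are unitary on `L²`
    (∀ (τ : ℝ) (f : L2),
      ∃ M : L2 ≃ₗᵢ[ℂ] L2,
        (∀ h, M h = phaseMul (fun x => τ * ‖f x‖ ^ (2 * σ))
          (aemeasurable_nlPhase σ τ f) h) ∧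
        M f = nlStep σ τ f) ∧
    (∀ r : ℝ, ∃ L : L2 ≃ₗᵢ[ℂ] L2,
      ∀ h, L h = freeStep r h) := by
  refine ⟨.of_forall fun ω =>
      ⟨fun n _ => ?_, fun n _ u => ?_, fun n _ u h k => ?_, fun n _ u => ?_⟩,
    exists_nonlinear_flow hs σ, fun n _ u₀ => ?_, fun v hv => ?_, fun τ f => ?_,
    fun r => ⟨freeStepₗᵢ r, fun _ => rfl⟩⟩
  · exact ⟨lieHs hs σ T N (W · ω) n, toL2_lieHs hs σ T N (W · ω) n,
      differentiable_lieHs hs σ T N (W · ω) n⟩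
  · exact (hasFDerivAt_lieScheme hs σ T N (W · ω) n u).differentiableAt
  · exact schemeForm_succ hs σ T N (W · ω) n u h k
  · exact charge_lieScheme_succ σ T N (W · ω) n u
  · exact solvesLinearEquation_freeStep hW _ _ fun ω =>
      (norm_lieIntermediate σ T N (W · ω) n u₀).le
  · exact ⟨freeStep_zero v, exists_linear_flow hv⟩
  · exact ⟨phaseMulₗᵢ _ (aemeasurable_nlPhase σ τ f), fun _ => rfl, rfl⟩
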